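/- Let $d\ge 2$, let $P$ be the uniform distribution on $[0,1]^d$, and let $\mathcal M_d$ be the class of all $f:[0,1]^d\to\mathbb R$ with $f(x)\le f(y)$ whenever $x\le y$ coordinatewise. Let $X_1,\dots,X_n$ be i.i.d. with law $P$, let $\xi_1,\dots,\xi_n$ be i.i.d. $\mathcal N(0,1)$ and independent of $(X_1,\dots,X_n)$, and let $Y_i=f_0(X_i)+\xi_i$ for $1\le i\le n$. Let $\widehat f_n$ be an isotonic least squares estimator, that is, a minimizer of $\sum_{i=1}^n (Y_i-f(X_i))^2$ over $f\in\mathcal M_d$; since this criterion determines $\widehat f_n$ only at the design points, $\widehat f_n$ is taken to be any minimizer with $\min_i \widehat f_n(X_i)\le \widehat f_n(x)\le\max_i\widehat f_n(X_i)$ for all $x\in[0,1]^d$. Put $\gamma_d=2$ if $d=2$ and $\gamma_d=1$ if $d\ge 3$. Then there is a constant $C_d>0$, depending only on $d$, such that for all $n\ge 1$, $$\sup_{f_0\in\mathcal M_d,\ \sup_x|f_0(x)|\le 1}\ \mathbb E_{f_0}\int_{[0,1]^d}\big(\widehat f_n(x)-f_0(x)\big)^2\,dP(x)\ \le\ C_d\,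 n^{-1/d}\,\big(\log (e\vee n)\big)^{\gamma_d}.$$ The bound holds for every such choice of $\widehat f_n$, with outer expectation if the choice is not measurable. -/

import Mathlib

open MeasureTheory ProbabilityTheory
open scoped ENNReal

namespace IsotonicRegression

/-- The cube `[0,1]^d`, with the coordinatewise order and the product of the uniform measures on
`[0,1]`; the measure `volume` on it is the uniform distribution `P`. -/
abbrev Cube (d : ℕ) : Type := Fin d → Set.Icc (0 : ℝ) 1

/-- `M_d`: the functions `f : [0,1]^d → ℝ` with `f x ≤ f y` whenever `x ≤ y` coordinatewise. -/
def isotonicClass (d : ℕ) : Set (Cube d → ℝ) := {f | ∀ x y : Cube d, x ≤ y → f x ≤ f y}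

/-- `L_∞(B)`: the functions on the cube that are bounded by `B` in absolute value. -/
def supBall (d : ℕ) (B : ℝ) : Set (Cube d → ℝ) := {f | ∀ x : Cube d, |f x| ≤ B}

/-- The residual sum of squares `∑ (Y_i - f(X_i))²`. -/
def rss {d n : ℕ} (X : Fin n → Cube d) (Y : Fin n → ℝ) (f : Cube d → ℝ) : ℝ :=
  ∑ i, (Y i - f (X i)) ^ 2

/-- `f` is an isotonic least squares estimator for the data `(X_i, Y_i)`. The least squares
criterion sees `f` only through the fitted values `f (X i)`; the third field is the normalisation
of the interpolation to the cube: `f` stays within the range of its fitted values. -/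
structure IsIsotonicLSE {d n : ℕ} (X : Fin n → Cube d) (Y : Fin n → ℝ) (f : Cube d → ℝ) :
    Prop where
  isotonic : f ∈ isotonicClass d
  minimal : ∀ g ∈ isotonicClass d, rss X Y f ≤ rss X Y g
  range : ∀ x : Cube d, (∃ i, f (X i) ≤ f x) ∧ (∃ j, f x ≤ f (X j))

/-- The random design regression model: the `X_i` are i.i.d. uniform on the cube, the `ξ_i` are
i.i.d. standard Gaussian, and the design is independent of the noise. -/
structure IsDesignNoise {d n : ℕ} {Ω : Type*} [MeasurableSpace Ω] (μ : Measure Ω)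
    (X : Fin n → Ω → Cube d) (ξ : Fin n → Ω → ℝ) : Prop where
  law_X : ∀ i, HasLaw (X i) (volume : Measure (Cube d)) μ
  law_noise : ∀ i, HasLaw (ξ i) (gaussianReal 0 1) μ
  indep_X : iIndepFun X μ
  indep_noise : iIndepFun ξ μ
  indep_X_noise : IndepFun (fun ω i => X i ω) (fun ω i => ξ i ω) μ

/-- The squared `L_2(P)` distance, `P` being uniform on the cube. -/
noncomputable def sqL2Dist {d : ℕ} (f g : Cube d → ℝ) : ℝ≥0∞ :=
  ∫⁻ x, ENNReal.ofReal ((f x - g x) ^ 2)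

/-- Outer expectation of a nonnegative function, which is the expectation when the function is
measurable. It makes sense of the risk of an arbitrary, possibly non-measurable, choice of
least squares estimator. -/
noncomputable def outerExpectation {Ω : Type*} [MeasurableSpace Ω] (μ : Measure Ω)
    (F : Ω → ℝ≥0∞) : ℝ≥0∞ :=
  ⨅ (G : Ω → ℝ≥0∞) (_ : Measurable G) (_ : ∀ ω, F ω ≤ G ω), ∫⁻ ω, G ω ∂μ

theorem outerExpectation_eq_lintegral {Ω : Type*} [MeasurableSpace Ω] (μ : Measure Ω)
    {F : Ω → ℝ≥0∞} (hF : Measurable F) : outerExpectation μ F = ∫⁻ ω, F ω ∂μ := by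
  apply le_antisymm
  · exact iInf_le_of_le F (iInf_le_of_le hF (iInf_le_of_le (fun _ => le_rfl) le_rfl))
  · exact le_iInf fun G => le_iInf fun _ => le_iInf fun h => lintegral_mono h

/-- The convention `log x = log (e ∨ x)`. -/
noncomputable def logE (x : ℝ) : ℝ := Real.log (max (Real.exp 1) x)

/-- The exponent of the logarithm: `2` if `d = 2`, and `1` if `d ≥ 3`. -/
def gammaIso (d : ℕ) : ℕ := if d = 2 then 2 else 1

end IsotonicRegression

/-! No localisation is needed: a uniform bound on the empirical process over bounded monotone
functions, of order `n^(1-1/d)` up to a logarithm when `d = 2`, already gives the rate. Write `B = 1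
+ 4√(log n)`. When all noise is at most `B - 1` in absolute value, clipping shows that the estimator
is bounded by `B` (`IsIsotonicLSE.abs_le`). The basic inequality `∑ (f̂ - f₀)² ≤ 2 ∑ ξ (f̂ - f₀)` is
then rewritten, after adding `B` to both functions, in terms of sums `∑ w(ξ_i) φ(X_i)` with
nonnegative weights `w` and nonnegative monotone `φ`: the noise is split into positive and negative
parts, the square into products (`IsIsotonicLSE.sqL2Dist_le`). Nonnegativity allows `φ` to be
bracketed by its values at the lower and upper corners of grid cells, and telescoping makes the mean
bracket width `O(1/m)` (`integral_osc_le`). The layer-cake formula reduces monotone functions to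
upper sets. Upper sets are chained over dyadic grids (`IsWeight.exists_upperSet_envelope`). At scale
`2^(-k)` there are `exp(O(2^(k(d-1))))` increments, of volume `O(2^(-k))`, contributing about `√(n
2^(k(d-2)))`. With `2^(Kd) ≈ n` the last scale gives `2^(K(d-1)) ≈ n^(1-1/d)`. The contributions are
geometric if `d ≥ 3` and all equal if `d = 2`, which costs one logarithm; the other logarithm is
`B²`. Large noise is handled by an exponential majorant of mean `O(1/n)`. All bounds are assembled
into one integrable function of the sample dominating the loss of every estimator
(`exists_loss_envelope`), so measurability of the choice is irrelevant. -/

namespace IsotonicRegression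

/-! ### Counting upper sets of a grid -/

/-- The number of points of `T` on the line in direction of the second coordinate. -/
noncomputable def columnCount {e m : ℕ} (T : Finset (Fin (e + 2) → Fin m)) (r : Fin e → Fin m)
    (i : Fin m) : ℕ := by
  classical
  exact (Finset.univ.filter fun j : Fin m =>
    (Fin.cons i (Fin.cons j r : Fin (e + 1) → Fin m) : Fin (e + 2) → Fin m) ∈ T).card

theorem columnCount_le {e m : ℕ} (T : Finset (Fin (e + 2) → Fin m)) (r : Fin e → Fin m)
    (i : Fin m) : columnCount T r i ≤ m := by
  classical
  unfold columnCount
  exact (Finset.card_le_univ _).trans (by simp)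

theorem columnCount_mono {e m : ℕ} {T : Finset (Fin (e + 2) → Fin m)}
    (hT : IsUpperSet (T : Set (Fin (e + 2) → Fin m))) (r : Fin e → Fin m) :
    Monotone (columnCount T r) := by
  classical
  intro i i' hi
  unfold columnCount
  refine Finset.card_le_card fun j hj => ?_
  simp only [Finset.mem_filter, Finset.mem_univ, true_and] at hj ⊢
  refine hT ?_ hj
  exact Fin.cons_le_cons.2 ⟨hi, le_rfl⟩

theorem fin_upper_eq_of_card_eq {m : ℕ} {A B : Finset (Fin m)}
    (hA : IsUpperSet (A : Set (Fin m))) (hB : IsUpperSet (B : Set (Fin m)))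
    (h : A.card = B.card) : A = B := by
  rcases hA.total hB with hAB | hAB
  · exact Finset.eq_of_subset_of_card_le (by exact_mod_cast hAB) h.ge
  · exact (Finset.eq_of_subset_of_card_le (by exact_mod_cast hAB) h.le).symm

theorem eq_of_columnCount_eq {e m : ℕ} {T T' : Finset (Fin (e + 2) → Fin m)}
    (hT : IsUpperSet (T : Set (Fin (e + 2) → Fin m)))
    (hT' : IsUpperSet (T' : Set (Fin (e + 2) → Fin m)))
    (h : ∀ r i, columnCount T r i = columnCount T' r i) : T = T' := by
  classical
  ext g
  obtain ⟨i, g', rfl⟩ : ∃ i g', g = Fin.cons i g' := ⟨g 0, Fin.tail g, (Fin.cons_self_tail g).symm⟩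
  obtain ⟨j, r, rfl⟩ : ∃ i r, g' = Fin.cons i r := ⟨g' 0, Fin.tail g', (Fin.cons_self_tail g').symm⟩
  have up : ∀ S : Finset (Fin (e + 2) → Fin m), IsUpperSet (S : Set (Fin (e + 2) → Fin m)) →
      IsUpperSet ((Finset.univ.filter fun j : Fin m =>
        (Fin.cons i (Fin.cons j r : Fin (e + 1) → Fin m) : Fin (e + 2) → Fin m) ∈ S :
          Finset (Fin m)) : Set (Fin m)) := by
    intro S hS j j' hj h1
    simp only [Finset.coe_filter, Finset.mem_univ, true_and, Set.mem_ofPred_eq] at h1 ⊢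
    refine hS ?_ h1
    exact Fin.cons_le_cons.2 ⟨le_rfl, Fin.cons_le_cons.2 ⟨hj, le_rfl⟩⟩
  have key := fin_upper_eq_of_card_eq (up T hT) (up T' hT') (h r i)
  have := congrArg (j ∈ ·) key
  simpa using this

/-- The number of upper sets of the grid `m^d` is at most exponential in `m^(d-1)`. -/
theorem card_upperSet_le (e m : ℕ) (U : Finset (Finset (Fin (e + 2) → Fin m)))
    (hU : ∀ T ∈ U, IsUpperSet (T : Set (Fin (e + 2) → Fin m))) :
    U.card ≤ 2 ^ (2 * m * m ^ e) := by
  classical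
  -- Column heights are monotone in `i`, so adding `i` makes them strictly monotone; a strictly
  -- monotone map is determined by its range, one of the `2^(2m)` subsets of `Fin (2 * m)`. There is
  -- one such map for each of the `m^e` values of `r`.
  let sh : Finset (Fin (e + 2) → Fin m) → (Fin e → Fin m) → Fin m → Fin (2 * m) := fun T r i =>
    ⟨columnCount T r i + i, by have := columnCount_le T r i; omega⟩
  have sh_mono : ∀ T ∈ U, ∀ r, StrictMono (sh T r) := by
    intro T hT r i i' hi
    have h1 := columnCount_mono (hU T hT) r hi.le
    have h2 : (i : ℕ) < i' := hi
    change columnCount T r i + (i : ℕ) < columnCount T r i' + (i' : ℕ)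
    omega
  let code : Finset (Fin (e + 2) → Fin m) → ((Fin e → Fin m) → Finset (Fin (2 * m))) :=
    fun T r => Finset.univ.image (sh T r)
  have inj : Set.InjOn code U := by
    intro T hT T' hT' h
    refine eq_of_columnCount_eq (hU T hT) (hU T' hT') fun r i => ?_
    have h1 : Finset.univ.image (sh T r) = Finset.univ.image (sh T' r) := congrFun h r
    have h2 : Set.range (sh T r) = Set.range (sh T' r) := by
      have := congrArg (fun s : Finset (Fin (2 * m)) => (s : Set (Fin (2 * m)))) h1
      simpa using this
    have h3 := (StrictMono.range_inj (sh_mono T hT r) (sh_mono T' hT' r)).1 h2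
    have h4 : columnCount T r i + (i : ℕ) = columnCount T' r i + i :=
      congrArg Fin.val (congrFun h3 i)
    omega
  have := Finset.card_le_card_of_injOn code (t := Finset.univ) (fun _ _ => Finset.mem_coe.2 (Finset.mem_univ _)) inj
  refine this.trans (le_of_eq ?_)
  rw [Finset.card_univ, Fintype.card_fun, Fintype.card_finset, Fintype.card_fun]
  simp only [Fintype.card_fin]
  rw [← pow_mul]

/-! ### Grids on the cube -/

/-- The index of the cell of the grid of mesh `1/m` that contains `x`. -/
noncomputable def cellIx {d : ℕ} (m : ℕ) (x : Cube d) : Fin d → ℕ := fun i => ⌊(m : ℝ) * (x i : ℝ)⌋₊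

/-- The grid point with index `g`, clipped to the cube. -/
noncomputable def gridPt {d : ℕ} (m : ℕ) (g : Fin d → ℕ) : Cube d := fun i =>
  ⟨min ((g i : ℝ) / m) 1, le_min (by positivity) zero_le_one, min_le_right _ _⟩

theorem gridPt_mono {d : ℕ} (m : ℕ) : Monotone (gridPt (d := d) m) := by
  intro g g' h i
  refine Subtype.mk_le_mk.2 (min_le_min_right _ ?_)
  have : (g i : ℝ) ≤ g' i := by exact_mod_cast h i
  gcongr

theorem gridPt_cellIx_le {d : ℕ} (m : ℕ) (x : Cube d) : gridPt m (cellIx m x) ≤ x := by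
  intro i
  refine Subtype.coe_le_coe.1 ((min_le_left _ _).trans ?_)
  have hx := (x i).2.1
  refine div_le_of_le_mul₀ (by positivity) hx ?_
  rw [mul_comm]
  exact Nat.floor_le (by positivity)

theorem le_gridPt_cellIx {d : ℕ} {m : ℕ} (hm : 0 < m) (x : Cube d) :
    x ≤ gridPt m (cellIx m x + 1) := by
  intro i
  refine Subtype.coe_le_coe.1 (le_min ?_ (x i).2.2)
  have hm' : (0 : ℝ) < m := by exact_mod_cast hm
  rw [le_div_iff₀ hm', mul_comm]
  have := (Nat.lt_floor_add_one ((m : ℝ) * (x i : ℝ))).le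
  simpa [cellIx] using this

/-- The value `m` is attained when `x i = 1`, hence `m + 1` indices per axis. -/
theorem cellIx_le {d : ℕ} (m : ℕ) (x : Cube d) (i : Fin d) : cellIx m x i ≤ m := by
  refine Nat.floor_le_of_le ?_
  exact mul_le_of_le_one_right (by positivity) (x i).2.2

theorem cellIx_two_mul {d : ℕ} (m : ℕ) (x : Cube d) (i : Fin d) :
    cellIx (2 * m) x i / 2 = cellIx m x i := by
  unfold cellIx
  have := Nat.floor_div_natCast (((2 * m : ℕ) : ℝ) * (x i : ℝ)) 2
  rw [← this]
  congr 1
  push_cast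
  ring

theorem gridPt_two_mul {d : ℕ} (m : ℕ) (g : Fin d → ℕ) :
    gridPt (2 * m) (fun i => 2 * g i) = gridPt m g := by
  funext i
  apply Subtype.ext
  simp only [gridPt]
  congr 1
  push_cast
  exact mul_div_mul_left _ _ two_ne_zero

theorem measurable_cellIx {d : ℕ} (m : ℕ) : Measurable (cellIx (d := d) m) := by
  refine measurable_pi_iff.2 fun i => ?_
  exact Nat.measurable_floor.comp (measurable_const.mul (measurable_subtype_coe.comp (measurable_pi_apply i)))

/-- The indices of the cells meeting the cube. -/
def gridIx (d m : ℕ) : Finset (Fin d → ℕ) := Fintype.piFinset fun _ => Finset.range (m + 1)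

theorem cellIx_mem {d : ℕ} (m : ℕ) (x : Cube d) : cellIx m x ∈ gridIx d m :=
  Fintype.mem_piFinset.2 fun i => Finset.mem_range.2 (Nat.lt_succ_of_le (cellIx_le m x i))

theorem integrable_comp_cellIx {d : ℕ} (m : ℕ) (F : (Fin d → ℕ) → ℝ) :
    Integrable (fun x : Cube d => F (cellIx m x)) := by
  refine Integrable.of_bound (C := ∑ g ∈ gridIx d m, |F g|)
    ((Measurable.of_discrete (f := F)).comp (measurable_cellIx m)).aestronglyMeasurable ?_
  refine Filter.Eventually.of_forall fun x => ?_
  exact Finset.single_le_sum (f := fun g => |F g|) (fun _ _ => abs_nonneg _) (cellIx_mem m x)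

/-- The uniform mass of a cell. -/
noncomputable def cellMass (d m : ℕ) (g : Fin d → ℕ) : ℝ :=
  (volume : Measure (Cube d)).real (cellIx m ⁻¹' {g})

theorem integral_comp_cellIx {d : ℕ} (m : ℕ) (F : (Fin d → ℕ) → ℝ) :
    ∫ x : Cube d, F (cellIx m x) = ∑ g ∈ gridIx d m, F g * cellMass d m g := by
  have h : ∀ x : Cube d, F (cellIx m x) =
      ∑ g ∈ gridIx d m, (cellIx m ⁻¹' {g}).indicator (fun _ => F g) x := by
    intro x
    rw [Finset.sum_eq_single (cellIx m x)]
    · simp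
    · intro g _ hg
      simp [Set.indicator, hg.symm]
    · intro h
      exact absurd (cellIx_mem m x) h
  have hms : ∀ g, MeasurableSet (cellIx (d := d) m ⁻¹' {g}) := fun g =>
    measurable_cellIx m (MeasurableSet.of_discrete)
  simp_rw [h]
  rw [integral_finsetSum]
  · refine Finset.sum_congr rfl fun g _ => ?_
    rw [integral_indicator (hms g)]
    simp [cellMass, mul_comm]
  · intro g _
    exact (integrable_const _).indicator (hms g)

theorem cellMass_le {d m : ℕ} (hm : 0 < m) (g : Fin d → ℕ) :
    cellMass d m g ≤ (1 / (m : ℝ)) ^ d := by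
  have hm' : (0 : ℝ) < m := by exact_mod_cast hm
  have hsub : cellIx (d := d) m ⁻¹' {g} ⊆ Set.univ.pi fun i =>
      (Subtype.val ⁻¹' Set.Icc ((g i : ℝ) / m) (((g i : ℝ) + 1) / m) : Set (Set.Icc (0 : ℝ) 1)) := by
    intro x hx i _
    have hi : ⌊(m : ℝ) * (x i : ℝ)⌋₊ = g i := congrFun hx i
    have hnn : (0 : ℝ) ≤ (m : ℝ) * (x i : ℝ) := mul_nonneg hm'.le (x i).2.1
    have h1 := Nat.floor_le hnn
    have h2 := Nat.lt_floor_add_one ((m : ℝ) * (x i : ℝ))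
    rw [hi] at h1 h2
    constructor
    · rw [div_le_iff₀ hm']; linarith
    · rw [le_div_iff₀ hm']; linarith
  have h1 : (volume : Measure (Cube d)) (cellIx m ⁻¹' {g}) ≤ ENNReal.ofReal (1 / (m : ℝ)) ^ d := by
    refine (measure_mono hsub).trans ?_
    rw [volume_pi_pi]
    calc _ ≤ ∏ _i : Fin d, ENNReal.ofReal (1 / (m : ℝ)) := by
          refine Finset.prod_le_prod' fun i _ => ?_
          rw [Measure.Subtype.volume_def, Measure.comap_apply₀]
          · refine (measure_mono (Set.image_preimage_subset _ _)).trans ?_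
            rw [Real.volume_Icc]
            apply ENNReal.ofReal_le_ofReal
            apply le_of_eq
            field_simp
            ring
          · exact Subtype.val_injective
          · intro s hs
            exact (MeasurableEmbedding.subtype_coe measurableSet_Icc).measurableSet_image.2 hs |>.nullMeasurableSet
          · exact (measurable_subtype_coe measurableSet_Icc).nullMeasurableSet
      _ = _ := by simp
  have h2 := ENNReal.toReal_mono (by simp) h1
  rw [ENNReal.toReal_pow, ENNReal.toReal_ofReal (by positivity)] at h2
  exact h2

/-- Telescoping along the diagonal: the oscillation of a monotone function over the cells. -/
theorem sum_grid_osc_le {d m : ℕ} (hm : 0 < m) {F : (Fin d → ℕ) → ℝ} {H : ℝ}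
    (h0 : ∀ g, 0 ≤ F g) (h1 : ∀ g, F g ≤ H) :
    ∑ g ∈ gridIx d m, (F (g + 1) - F g) ≤ H * (d * 2 ^ d * (m : ℝ) ^ (d - 1)) := by
  classical
  have hH : 0 ≤ H := (h0 0).trans (h1 0)
  rw [Finset.sum_sub_distrib]
  have himg : ∑ g ∈ gridIx d m, F (g + 1) = ∑ g ∈ (gridIx d m).image (· + 1), F g := by
    rw [Finset.sum_image]
    intro a _ b _ h
    exact add_right_cancel h
  rw [himg]
  set A := (gridIx d m).image (· + 1)
  -- The shifted grid cancels against the original one on the overlap; the lower boundary layer is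
  -- dropped because `F` is nonnegative, so only the new upper layer remains.
  have h2 : ∑ g ∈ A, F g ≤ ∑ g ∈ gridIx d m, F g + ∑ g ∈ A \ gridIx d m, F g := by
    rw [← Finset.sum_inter_add_sum_sdiff A (gridIx d m)]
    gcongr
    · exact fun _ _ _ => h0 _
    · exact Finset.inter_subset_right
  have h3 : ∑ g ∈ A \ gridIx d m, F g ≤ (A \ gridIx d m).card * H := by
    rw [← nsmul_eq_mul]
    exact Finset.sum_le_card_nsmul _ _ _ fun g _ => h1 g
  have h4 : (A \ gridIx d m).card ≤ d * (m + 1) ^ (d - 1) := by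
    rcases Nat.eq_zero_or_pos d with rfl | hd
    · have : A \ gridIx 0 m = ∅ := by
        refine Finset.eq_empty_of_forall_notMem fun g hg => ?_
        exact (Finset.mem_sdiff.1 hg).2 (Fintype.mem_piFinset.2 fun i => i.elim0)
      simp [this]
    -- A shifted index outside the grid has some coordinate equal to `m + 1`, leaving `d - 1` free
    -- coordinates.
    have hsub : A \ gridIx d m ⊆ Finset.univ.biUnion fun i : Fin d =>
        Fintype.piFinset fun j => if j = i then {m + 1} else Finset.Icc 1 (m + 1) := by
      intro g hg
      obtain ⟨hgA, hgn⟩ := Finset.mem_sdiff.1 hg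
      obtain ⟨a, ha, rfl⟩ := Finset.mem_image.1 hgA
      have ha' : ∀ i, a i < m + 1 := fun i => Finset.mem_range.1 (Fintype.mem_piFinset.1 ha i)
      have : ∃ i, ¬ (a i + 1 < m + 1) := by
        by_contra hcon
        push Not at hcon
        exact hgn (Fintype.mem_piFinset.2 fun i => Finset.mem_range.2 (hcon i))
      obtain ⟨i, hi⟩ := this
      refine Finset.mem_biUnion.2 ⟨i, Finset.mem_univ _, Fintype.mem_piFinset.2 fun j => ?_⟩
      have := ha' j
      have := ha' i
      split_ifs with hj
      · subst hj
        simp only [Finset.mem_singleton, Pi.add_apply, Pi.one_apply]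
        omega
      · simp only [Finset.mem_Icc, Pi.add_apply, Pi.one_apply]
        omega
    refine (Finset.card_le_card hsub).trans (Finset.card_biUnion_le.trans ?_)
    refine (Finset.sum_le_card_nsmul _ _ ((m + 1) ^ (d - 1)) fun i _ => ?_).trans (by simp)
    rw [Fintype.card_piFinset]
    rw [← Finset.mul_prod_erase _ _ (Finset.mem_univ i)]
    rw [Finset.prod_congr rfl (g := fun _ => m + 1)]
    · simp [Finset.card_erase_of_mem]
    · intro j hj
      simp [Finset.ne_of_mem_erase hj]
  have h5 : ((A \ gridIx d m).card : ℝ) ≤ d * 2 ^ d * (m : ℝ) ^ (d - 1) := by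
    have hm1 : ((m : ℝ) + 1) ≤ 2 * m := by
      have : (1 : ℝ) ≤ m := by exact_mod_cast hm
      linarith
    calc ((A \ gridIx d m).card : ℝ) ≤ ((d * (m + 1) ^ (d - 1) : ℕ) : ℝ) := by exact_mod_cast h4
      _ = d * ((m : ℝ) + 1) ^ (d - 1) := by push_cast; ring
      _ ≤ d * (2 * (m : ℝ)) ^ (d - 1) := by gcongr
      _ = d * 2 ^ (d - 1) * (m : ℝ) ^ (d - 1) := by rw [mul_pow]; ring
      _ ≤ _ := by
        gcongr
        · norm_num
        · omega
  have h6 := mul_le_mul_of_nonneg_right h5 hH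
  linarith

/-- Cells have mass at most `m^(-d)`, while the telescoped sum is of order `m^(d-1)`. This controls
both the bracket width of monotone functions and the volume of the chaining increments. -/
theorem integral_osc_le {d m : ℕ} (hd : 1 ≤ d) (hm : 0 < m) {F : (Fin d → ℕ) → ℝ} {H : ℝ}
    (hF : Monotone F) (h0 : ∀ g, 0 ≤ F g) (h1 : ∀ g, F g ≤ H) :
    ∫ x : Cube d, (F (cellIx m x + 1) - F (cellIx m x)) ≤ H * (d * 2 ^ d / m) := by
  rw [integral_comp_cellIx m (fun g => F (g + 1) - F g)]
  have hm' : (0 : ℝ) < m := by exact_mod_cast hm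
  calc _ ≤ ∑ g ∈ gridIx d m, (F (g + 1) - F g) * (1 / (m : ℝ)) ^ d := by
        refine Finset.sum_le_sum fun g _ => ?_
        refine mul_le_mul_of_nonneg_left (cellMass_le hm g) (sub_nonneg.2 (hF ?_))
        exact le_add_of_nonneg_right (by intro i; simp)
    _ = (∑ g ∈ gridIx d m, (F (g + 1) - F g)) * (1 / (m : ℝ)) ^ d := by rw [Finset.sum_mul]
    _ ≤ (H * (d * 2 ^ d * (m : ℝ) ^ (d - 1))) * (1 / (m : ℝ)) ^ d := by
        gcongr
        exact sum_grid_osc_le hm h0 h1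
    _ = _ := by
        obtain ⟨e, rfl⟩ : ∃ e, d = e + 1 := ⟨d - 1, by omega⟩
        simp only [Nat.add_sub_cancel, one_div_pow]
        field_simp
        ring

/-! ### Exponential moments and a maximal inequality -/

/-- The joint law of one design point and its noise. -/
noncomputable abbrev obsLaw (d : ℕ) : Measure (Cube d × ℝ) :=
  (volume : Measure (Cube d)).prod (gaussianReal 0 1)

/-- The joint law of `n` design points and their noise. -/
noncomputable abbrev sampleLaw (d n : ℕ) : Measure (Fin n → Cube d × ℝ) :=
  Measure.pi fun _ => obsLaw d

/-- Nonnegative weights of at most linear growth. -/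
structure IsWeight (w : ℝ → ℝ) : Prop where
  meas : Measurable w
  nonneg : ∀ z, 0 ≤ w z
  le : ∀ z, w z ≤ 1 + |z|

/-- The mean weight. -/
noncomputable def wMean (w : ℝ → ℝ) : ℝ := ∫ z, w z ∂(gaussianReal 0 1)

/-- A bound for the second exponential moments of all weights. -/
noncomputable def wBound : ℝ := ∫ z, 2 * Real.exp (2 * (1 + |z|)) ∂(gaussianReal 0 1)

theorem exp_mul_abs_le (t z : ℝ) : Real.exp (t * |z|) ≤ Real.exp (t * z) + Real.exp (-t * z) := by
  rcases abs_choice z with h | h <;> rw [h]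
  · exact le_add_of_nonneg_right (Real.exp_pos _).le
  · rw [mul_neg, ← neg_mul]
    exact le_add_of_nonneg_left (Real.exp_pos _).le

theorem integrable_exp_mul_abs (t : ℝ) :
    Integrable (fun z => Real.exp (t * |z|)) (gaussianReal 0 1) := by
  refine Integrable.mono' (g := fun z => Real.exp (t * z) + Real.exp (-t * z))
    ((integrable_exp_mul_gaussianReal t).add (integrable_exp_mul_gaussianReal (-t)))
    (by fun_prop) (Filter.Eventually.of_forall fun z => ?_)
  rw [Real.norm_of_nonneg (Real.exp_pos _).le]
  exact exp_mul_abs_le t z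

theorem integrable_wBound :
    Integrable (fun z => 2 * Real.exp (2 * (1 + |z|))) (gaussianReal 0 1) := by
  have := ((integrable_exp_mul_abs 2).const_mul (2 * Real.exp 2))
  refine this.congr (Filter.Eventually.of_forall fun z => ?_)
  simp only
  rw [mul_assoc, ← Real.exp_add]
  ring_nf

theorem IsWeight.abs_eq {w : ℝ → ℝ} (hw : IsWeight w) (z : ℝ) : |w z| = w z :=
  abs_of_nonneg (hw.nonneg z)

/-- Makes the second-order remainder of the exponential moment bounded by `wBound`, uniformly over
weights. -/
theorem IsWeight.sq_mul_exp_le {w : ℝ → ℝ} (hw : IsWeight w) (z : ℝ) :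
    w z ^ 2 * Real.exp (w z) ≤ 2 * Real.exp (2 * (1 + |z|)) := by
  have h1 := Real.quadratic_le_exp_of_nonneg (hw.nonneg z)
  have h2 : w z ^ 2 ≤ 2 * Real.exp (w z) := by nlinarith [hw.nonneg z]
  calc _ ≤ 2 * Real.exp (w z) * Real.exp (w z) := by gcongr
    _ = 2 * Real.exp (2 * w z) := by rw [mul_assoc, ← Real.exp_add]; ring_nf
    _ ≤ _ := by have := hw.le z; gcongr

theorem IsWeight.le_exp {w : ℝ → ℝ} (hw : IsWeight w) (z : ℝ) :
    w z ≤ 2 * Real.exp (2 * (1 + |z|)) := by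
  have h1 := Real.add_one_le_exp (2 * (1 + |z|))
  have := hw.le z
  have := abs_nonneg z
  linarith

theorem IsWeight.integrable {w : ℝ → ℝ} (hw : IsWeight w) :
    Integrable w (gaussianReal 0 1) := by
  refine integrable_wBound.mono' hw.meas.aestronglyMeasurable (Filter.Eventually.of_forall fun z => ?_)
  rw [Real.norm_eq_abs, hw.abs_eq]
  exact hw.le_exp z

theorem IsWeight.mean_nonneg {w : ℝ → ℝ} (hw : IsWeight w) : 0 ≤ wMean w :=
  integral_nonneg hw.nonneg

theorem IsWeight.mean_le {w : ℝ → ℝ} (hw : IsWeight w) : wMean w ≤ wBound :=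
  integral_mono hw.integrable integrable_wBound hw.le_exp

theorem wBound_nonneg : 0 ≤ wBound := integral_nonneg fun z => by positivity

/-- A Taylor bound valid on the whole line. For `x = t * w` with `|t| ≤ 1` the remainder is at most
`t² w² exp w`, which is integrable. -/
theorem exp_le_one_add_add_sq_mul (x : ℝ) : Real.exp x ≤ 1 + x + x ^ 2 * Real.exp |x| := by
  rcases le_or_gt |x| 1 with h | h
  · have h1 := (abs_le.1 (Real.abs_exp_sub_one_sub_id_le h)).2
    have h2 : x ^ 2 ≤ x ^ 2 * Real.exp |x| :=
      le_mul_of_one_le_right (sq_nonneg x) (Real.one_le_exp (abs_nonneg x))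
    linarith
  · rcases abs_choice x with h' | h'
    · rw [h'] at h ⊢
      have : Real.exp x ≤ x ^ 2 * Real.exp x :=
        le_mul_of_one_le_left (Real.exp_pos x).le (by nlinarith)
      linarith
    · rw [h'] at h ⊢
      have h1 : Real.exp x ≤ 1 := Real.exp_le_one_iff.2 (by linarith)
      have h2 : x ^ 2 ≤ x ^ 2 * Real.exp (-x) :=
        le_mul_of_one_le_right (sq_nonneg x) (Real.one_le_exp (by linarith))
      nlinarith

/-- The centred weighted empirical process. -/
noncomputable def dev {d n : ℕ} (w : ℝ → ℝ) (z : Fin n → Cube d × ℝ) (φ : Cube d → ℝ) : ℝ :=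
  ∑ i, w (z i).2 * φ (z i).1 - n * wMean w * ∫ x, φ x

theorem measurable_indicator_fst {d : ℕ} {D : Set (Cube d)} (hD : MeasurableSet D) :
    Measurable (fun y : Cube d × ℝ => D.indicator (fun _ => (1 : ℝ)) y.1) :=
  (measurable_const.indicator hD).comp measurable_fst

theorem IsWeight.integrable_exp {w : ℝ → ℝ} (hw : IsWeight w) {d : ℕ} {D : Set (Cube d)}
    (hD : MeasurableSet D) {t : ℝ} (ht : |t| ≤ 1) :
    Integrable (fun y : Cube d × ℝ => Real.exp (t * (w y.2 * D.indicator (fun _ => (1 : ℝ)) y.1)))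
      (obsLaw d) := by
  have hb : Integrable (fun y : Cube d × ℝ => 2 * Real.exp (2 * (1 + |y.2|))) (obsLaw d) :=
    integrable_wBound.comp_snd (volume : Measure (Cube d))
  have hm := measurable_indicator_fst hD
  have hwm := hw.meas
  refine hb.mono' (Measurable.aestronglyMeasurable (by fun_prop)) (Filter.Eventually.of_forall fun y => ?_)
  rw [Real.norm_of_nonneg (Real.exp_pos _).le]
  have h1 : t * (w y.2 * D.indicator (fun _ => (1 : ℝ)) y.1) ≤ 2 * (1 + |y.2|) := by
    refine (le_abs_self _).trans ?_
    rw [abs_mul, abs_mul, hw.abs_eq]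
    have h2 : |D.indicator (fun _ => (1 : ℝ)) y.1| ≤ 1 := by
      by_cases h : y.1 ∈ D <;> simp [h]
    have h3 := hw.nonneg y.2
    have h4 := hw.le y.2
    calc _ ≤ 1 * (w y.2 * 1) := by gcongr
      _ ≤ _ := by linarith [abs_nonneg y.2]
  calc _ ≤ Real.exp (2 * (1 + |y.2|)) := Real.exp_le_exp.2 h1
    _ ≤ _ := by linarith [Real.exp_pos (2 * (1 + |y.2|))]

/-- The indicator takes only the values 0 and 1, so the Taylor remainder keeps it as a factor and
the variance term is proportional to the volume of `D`. The linear term is what centring removes. -/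
theorem IsWeight.integral_exp_le {w : ℝ → ℝ} (hw : IsWeight w) {d : ℕ} {D : Set (Cube d)}
    (hD : MeasurableSet D) {t : ℝ} (ht : |t| ≤ 1) :
    ∫ y, Real.exp (t * (w y.2 * D.indicator (fun _ => (1 : ℝ)) y.1)) ∂(obsLaw d) ≤
      Real.exp (t * (wMean w * volume.real D) + t ^ 2 * (wBound * volume.real D)) := by
  set χ : Cube d → ℝ := D.indicator (fun _ => (1 : ℝ)) with hχ
  have hχi : Integrable χ := (integrable_const (1 : ℝ)).indicator hD
  have hχint : ∫ x, χ x = volume.real D := by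
    rw [hχ, integral_indicator hD]; simp
  have hχ01 : ∀ x, χ x = 0 ∨ χ x = 1 := by
    intro x; by_cases h : x ∈ D <;> simp [hχ, h]
  have i1 : Integrable (fun y : Cube d × ℝ => χ y.1 * w y.2) (obsLaw d) := hχi.mul_prod hw.integrable
  have i2 : Integrable (fun y : Cube d × ℝ => χ y.1 * (2 * Real.exp (2 * (1 + |y.2|)))) (obsLaw d) :=
    hχi.mul_prod integrable_wBound
  have e1 : ∫ y, χ y.1 * w y.2 ∂(obsLaw d) = volume.real D * wMean w := by
    rw [← hχint]; exact integral_prod_mul χ w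
  have e2 : ∫ y, χ y.1 * (2 * Real.exp (2 * (1 + |y.2|))) ∂(obsLaw d) = volume.real D * wBound := by
    rw [← hχint]; exact integral_prod_mul χ (fun z => 2 * Real.exp (2 * (1 + |z|)))
  have key : ∀ y : Cube d × ℝ, Real.exp (t * (w y.2 * χ y.1)) ≤
      1 + t * (χ y.1 * w y.2) + t ^ 2 * (χ y.1 * (2 * Real.exp (2 * (1 + |y.2|)))) := by
    intro y
    have h1 := exp_le_one_add_add_sq_mul (t * (w y.2 * χ y.1))
    rcases hχ01 y.1 with h | h
    · simp [h]
    · rw [h] at h1 ⊢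
      simp only [mul_one, one_mul] at h1 ⊢
      have h2 : |t * w y.2| ≤ w y.2 := by
        rw [abs_mul, hw.abs_eq]; exact mul_le_of_le_one_left (hw.nonneg _) ht
      have h3 : (t * w y.2) ^ 2 * Real.exp |t * w y.2| ≤ t ^ 2 * (w y.2 ^ 2 * Real.exp (w y.2)) := by
        rw [mul_pow, mul_assoc]; gcongr
      have h4 := mul_le_mul_of_nonneg_left (hw.sq_mul_exp_le y.2) (sq_nonneg t)
      linarith
  have i3 := (i1.const_mul t)
  have i4 := (i2.const_mul (t ^ 2))
  have i5 : Integrable (fun y : Cube d × ℝ => 1 + t * (χ y.1 * w y.2)) (obsLaw d) :=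
    (integrable_const 1).add i3
  calc _ ≤ ∫ y, (1 + t * (χ y.1 * w y.2) + t ^ 2 * (χ y.1 * (2 * Real.exp (2 * (1 + |y.2|))))) ∂(obsLaw d) :=
        integral_mono (hw.integrable_exp hD ht) (i5.add i4) key
    _ = 1 + t * (volume.real D * wMean w) + t ^ 2 * (volume.real D * wBound) := by
        rw [integral_add i5 i4, integral_add (integrable_const 1) i3,
          integral_const_mul, integral_const_mul, e1, e2]
        simp
    _ ≤ _ := by
        have := Real.add_one_le_exp (t * (wMean w * volume.real D) + t ^ 2 * (wBound * volume.real D))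
        linarith

theorem exp_mul_dev_indicator {d n : ℕ} (w : ℝ → ℝ) {D : Set (Cube d)} (hD : MeasurableSet D)
    (t : ℝ) (z : Fin n → Cube d × ℝ) :
    Real.exp (t * dev w z (D.indicator fun _ => 1)) =
      Real.exp (-(n * (t * (wMean w * volume.real D)))) *
      ∏ i, Real.exp (t * (w (z i).2 * D.indicator (fun _ => (1 : ℝ)) (z i).1)) := by
  rw [← Real.exp_sum, ← Real.exp_add, ← Finset.mul_sum, dev, integral_indicator hD]
  congr 1
  simp
  ring

theorem IsWeight.integrable_exp_dev {w : ℝ → ℝ} (hw : IsWeight w) {d n : ℕ} {D : Set (Cube d)}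
    (hD : MeasurableSet D) {t : ℝ} (ht : |t| ≤ 1) :
    Integrable (fun z => Real.exp (t * dev w z (D.indicator fun _ => 1))) (sampleLaw d n) := by
  simp_rw [exp_mul_dev_indicator w hD t]
  refine Integrable.const_mul ?_ _
  exact Integrable.fintype_prod (f := fun (_ : Fin n) (y : Cube d × ℝ) =>
    Real.exp (t * (w y.2 * D.indicator (fun _ => (1 : ℝ)) y.1))) fun _ => hw.integrable_exp hD ht

theorem IsWeight.integral_exp_dev_le {w : ℝ → ℝ} (hw : IsWeight w) {d n : ℕ} {D : Set (Cube d)}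
    (hD : MeasurableSet D) {t : ℝ} (ht : |t| ≤ 1) :
    ∫ z, Real.exp (t * dev w z (D.indicator fun _ => 1)) ∂(sampleLaw d n) ≤
      Real.exp (n * t ^ 2 * wBound * volume.real D) := by
  simp_rw [exp_mul_dev_indicator w hD t]
  rw [integral_const_mul, integral_fintype_prod_eq_pow (fun y : Cube d × ℝ =>
    Real.exp (t * (w y.2 * D.indicator (fun _ => (1 : ℝ)) y.1)))]
  calc _ ≤ Real.exp (-(n * (t * (wMean w * volume.real D)))) *
        Real.exp (t * (wMean w * volume.real D) + t ^ 2 * (wBound * volume.real D)) ^ n := by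
        simp only [Fintype.card_fin]
        have := hw.integral_exp_le hD ht
        have h0 : 0 ≤ ∫ y, Real.exp (t * (w y.2 * D.indicator (fun _ => (1 : ℝ)) y.1)) ∂(obsLaw d) :=
          integral_nonneg fun _ => (Real.exp_pos _).le
        gcongr
    _ = _ := by
        rw [← Real.exp_nat_mul, ← Real.exp_add]
        ring_nf

/-- A maximal inequality for the empirical process over a finite class of sets. -/
theorem IsWeight.exists_envelope {w : ℝ → ℝ} (hw : IsWeight w) {d n : ℕ} {𝒟 : Set (Set (Cube d))}
    (hfin : 𝒟.Finite) {N : ℝ} (hN : (𝒟.ncard : ℝ) ≤ N) (hN1 : 1 ≤ N)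
    (hmeas : ∀ D ∈ 𝒟, MeasurableSet D) {v : ℝ} (hv : ∀ D ∈ 𝒟, volume.real D ≤ v)
    {t : ℝ} (ht0 : 0 < t) (ht1 : t ≤ 1) :
    ∃ G : (Fin n → Cube d × ℝ) → ℝ, Integrable G (sampleLaw d n) ∧
      (∫ z, G z ∂(sampleLaw d n)) ≤ (Real.log (2 * N) + n * t ^ 2 * wBound * v) / t ∧
      ∀ z, ∀ D ∈ 𝒟, |dev w z (D.indicator fun _ => 1)| ≤ G z := by
  classical
  set L := Real.log (2 * N) + n * t ^ 2 * wBound * v with hL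
  set T := hfin.toFinset with hT
  have hmem : ∀ D, D ∈ T ↔ D ∈ 𝒟 := fun D => hfin.mem_toFinset
  have hcard : (T.card : ℝ) ≤ N := by rwa [hT, ← Set.ncard_eq_toFinset_card 𝒟 hfin]
  have ht : |t| ≤ 1 := by rwa [abs_of_pos ht0]
  have ht' : |-t| ≤ 1 := by rwa [abs_neg]
  let E : (Fin n → Cube d × ℝ) → ℝ := fun z => ∑ D ∈ T,
    (Real.exp (t * dev w z (D.indicator fun _ => 1)) + Real.exp (-t * dev w z (D.indicator fun _ => 1)))
  have hEi : ∀ D ∈ T, Integrable (fun z => Real.exp (t * dev w z (D.indicator fun _ => 1)) +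
      Real.exp (-t * dev w z (D.indicator fun _ => 1))) (sampleLaw d n) := fun D hD =>
    (hw.integrable_exp_dev (hmeas D ((hmem D).1 hD)) ht).add
      (hw.integrable_exp_dev (hmeas D ((hmem D).1 hD)) ht')
  have hE : Integrable E (sampleLaw d n) := integrable_finsetSum _ hEi
  have hEint : ∫ z, E z ∂(sampleLaw d n) ≤ Real.exp L := by
    rw [integral_finsetSum _ hEi]
    have h1 : ∀ D ∈ T, ∫ z, (Real.exp (t * dev w z (D.indicator fun _ => 1)) +
        Real.exp (-t * dev w z (D.indicator fun _ => 1))) ∂(sampleLaw d n) ≤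
        2 * Real.exp (n * t ^ 2 * wBound * v) := by
      intro D hD
      have hDm := hmeas D ((hmem D).1 hD)
      rw [integral_add (hw.integrable_exp_dev hDm ht) (hw.integrable_exp_dev hDm ht')]
      have h2 := hw.integral_exp_dev_le (n := n) hDm ht
      have h3 := hw.integral_exp_dev_le (n := n) hDm ht'
      rw [neg_sq] at h3
      have h4 : Real.exp (n * t ^ 2 * wBound * volume.real D) ≤ Real.exp (n * t ^ 2 * wBound * v) := by
        refine Real.exp_le_exp.2 (mul_le_mul_of_nonneg_left (hv D ((hmem D).1 hD)) ?_)
        have := wBound_nonneg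
        positivity
      linarith
    refine (Finset.sum_le_card_nsmul _ _ _ h1).trans ?_
    rw [nsmul_eq_mul, hL, Real.exp_add, Real.exp_log (by linarith)]
    have := Real.exp_pos (n * t ^ 2 * wBound * v)
    nlinarith
  -- The tangent line of `log` at `exp L` replaces Jensen: `log E ≤ L - 1 + exp (-L) * E`. The
  -- majorant is affine in `E`, hence integrable, with mean at most `L / t`.
  refine ⟨fun z => (L - 1 + Real.exp (-L) * E z) / t, ?_, ?_, ?_⟩
  · exact ((integrable_const _).add (hE.const_mul _)).div_const _
  · rw [integral_div, integral_add (integrable_const _) (hE.const_mul _), integral_const_mul]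
    have h1 : Real.exp (-L) * ∫ z, E z ∂(sampleLaw d n) ≤ 1 := by
      calc _ ≤ Real.exp (-L) * Real.exp L := by gcongr
        _ = 1 := by rw [← Real.exp_add]; simp
    simp only [integral_const, probReal_univ, smul_eq_mul, one_mul]
    gcongr
    linarith
  · intro z D hD
    rw [le_div_iff₀ ht0]
    have h0 : Real.exp (t * dev w z (D.indicator fun _ => 1)) +
      Real.exp (-t * dev w z (D.indicator fun _ => 1)) ≤ E z :=
      Finset.single_le_sum (f := fun D : Set (Cube d) => Real.exp (t * dev w z (D.indicator fun _ => 1)) +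
        Real.exp (-t * dev w z (D.indicator fun _ => 1))) (fun _ _ => by positivity) ((hmem D).2 hD)
    have h1 : Real.exp (t * |dev w z (D.indicator fun _ => 1)|) ≤ E z := (exp_mul_abs_le _ _).trans h0
    have h2 := Real.add_one_le_exp (t * |dev w z (D.indicator fun _ => 1)| - L)
    have h3 : Real.exp (t * |dev w z (D.indicator fun _ => 1)| - L) ≤ Real.exp (-L) * E z := by
      rw [sub_eq_add_neg, Real.exp_add, mul_comm]
      gcongr
    linarith

/-! ### Chaining over dyadic grids -/

/-- The union of the cells whose lower corner belongs to `C`. -/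
def levelSet {d : ℕ} (m : ℕ) (C : Set (Cube d)) : Set (Cube d) := {x | gridPt m (cellIx m x) ∈ C}

theorem measurableSet_levelSet {d : ℕ} (m : ℕ) (C : Set (Cube d)) : MeasurableSet (levelSet m C) :=
  measurable_cellIx m (MeasurableSet.of_discrete (s := {g | gridPt m g ∈ C}))

theorem gridPt_cellIx_eq {d : ℕ} (m : ℕ) (x : Cube d) :
    gridPt m (cellIx m x) = gridPt (2 * m) (fun i => 2 * (cellIx (2 * m) x i / 2)) := by
  simp_rw [cellIx_two_mul]
  exact (gridPt_two_mul m (cellIx m x)).symm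

theorem gridPt_cellIx_le_two_mul {d : ℕ} (m : ℕ) (x : Cube d) :
    gridPt m (cellIx m x) ≤ gridPt (2 * m) (cellIx (2 * m) x) := by
  rw [gridPt_cellIx_eq]
  exact gridPt_mono _ fun i => Nat.mul_div_le _ 2

theorem levelSet_subset_two_mul {d : ℕ} (m : ℕ) {C : Set (Cube d)} (hC : IsUpperSet C) :
    levelSet m C ⊆ levelSet (2 * m) C := fun x hx => hC (gridPt_cellIx_le_two_mul m x) hx

/-- The index of the cell of `x`, as an element of a finite type. -/
noncomputable def cellFin {d : ℕ} (m : ℕ) (x : Cube d) : Fin d → Fin (m + 1) := fun i =>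
  ⟨cellIx m x i, Nat.lt_succ_of_le (cellIx_le m x i)⟩

/-- The trace of a set on a grid. -/
noncomputable def trace {d : ℕ} (m : ℕ) (C : Set (Cube d)) : Finset (Fin d → Fin (m + 1)) := by
  classical
  exact Finset.univ.filter fun g => gridPt m (fun i => (g i : ℕ)) ∈ C

theorem mem_trace {d m : ℕ} {C : Set (Cube d)} {g : Fin d → Fin (m + 1)} :
    g ∈ trace m C ↔ gridPt m (fun i => (g i : ℕ)) ∈ C := by
  simp [trace]

theorem isUpperSet_trace {d : ℕ} (m : ℕ) {C : Set (Cube d)} (hC : IsUpperSet C) :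
    IsUpperSet (trace m C : Set (Fin d → Fin (m + 1))) := by
  intro g g' h hg
  rw [Finset.mem_coe, mem_trace] at hg ⊢
  exact hC (gridPt_mono m fun i => h i) hg

/-- Any family of sets read off from traces of upper sets is no larger than the number of upper sets
of the grid. -/
theorem finite_ncard_of_trace {e m : ℕ} {𝒟 : Set (Set (Cube (e + 2)))}
    (Φ : Finset (Fin (e + 2) → Fin (m + 1)) → Set (Cube (e + 2)))
    (h : ∀ D ∈ 𝒟, ∃ C, IsUpperSet C ∧ D = Φ (trace m C)) :
    𝒟.Finite ∧ 𝒟.ncard ≤ 2 ^ (2 * (m + 1) * (m + 1) ^ e) := by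
  classical
  let U : Finset (Finset (Fin (e + 2) → Fin (m + 1))) :=
    Finset.univ.filter fun T => IsUpperSet (T : Set (Fin (e + 2) → Fin (m + 1)))
  have hsub : 𝒟 ⊆ ((U.image Φ : Finset (Set (Cube (e + 2)))) : Set (Set (Cube (e + 2)))) := by
    intro D hD
    obtain ⟨C, hC, rfl⟩ := h D hD
    exact Finset.mem_coe.2 (Finset.mem_image_of_mem _ (Finset.mem_filter.2
      ⟨Finset.mem_univ _, isUpperSet_trace m hC⟩))
  refine ⟨(Finset.finite_toSet _).subset hsub, ?_⟩
  refine (Set.ncard_le_ncard hsub (Finset.finite_toSet _)).trans ?_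
  rw [Set.ncard_coe_finset]
  exact Finset.card_image_le.trans (card_upperSet_le e (m + 1) U fun T hT => (Finset.mem_filter.1 hT).2)

theorem levelSet_family {e : ℕ} (m : ℕ) :
    {D : Set (Cube (e + 2)) | ∃ C, IsUpperSet C ∧ D = levelSet m C}.Finite ∧
    {D : Set (Cube (e + 2)) | ∃ C, IsUpperSet C ∧ D = levelSet m C}.ncard ≤
      2 ^ (2 * (m + 1) * (m + 1) ^ e) := by
  refine finite_ncard_of_trace (fun T => {x | cellFin m x ∈ T}) ?_
  rintro D ⟨C, hC, rfl⟩
  refine ⟨C, hC, ?_⟩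
  ext x
  exact (mem_trace (g := cellFin m x)).symm

theorem increment_family {e : ℕ} (m : ℕ) :
    {D : Set (Cube (e + 2)) | ∃ C, IsUpperSet C ∧ D = levelSet (2 * m) C \ levelSet m C}.Finite ∧
    {D : Set (Cube (e + 2)) | ∃ C, IsUpperSet C ∧ D = levelSet (2 * m) C \ levelSet m C}.ncard ≤
      2 ^ (2 * (2 * m + 1) * (2 * m + 1) ^ e) := by
  -- The fine trace also determines the coarse level set: rounding each fine index down to an even
  -- number gives the coarse corner.
  refine finite_ncard_of_trace (fun T => {x | cellFin (2 * m) x ∈ T ∧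
    (fun i => (⟨2 * (cellFin (2 * m) x i / 2 : ℕ),
      by have := (cellFin (2 * m) x i).2; omega⟩ : Fin (2 * m + 1))) ∉ T}) ?_
  rintro D ⟨C, hC, rfl⟩
  refine ⟨C, hC, ?_⟩
  ext x
  simp only [Set.mem_sdiff, levelSet, Set.mem_ofPred_eq, mem_trace, cellFin, gridPt_cellIx_eq m x]

/-- A coarse cell meeting the increment has its lower corner outside `C` and its upper corner
inside, so the indicator of `C` oscillates by 1 over it. -/
theorem volume_increment_le {d m : ℕ} (hd : 1 ≤ d) (hm : 0 < m) {C : Set (Cube d)}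
    (hC : IsUpperSet C) :
    (volume : Measure (Cube d)).real (levelSet (2 * m) C \ levelSet m C) ≤ d * 2 ^ d / m := by
  classical
  set F : (Fin d → ℕ) → ℝ := fun g => C.indicator (fun _ => 1) (gridPt m g) with hF
  have h0 : ∀ g, 0 ≤ F g := fun g => Set.indicator_nonneg (fun _ _ => zero_le_one) _
  have h1 : ∀ g, F g ≤ 1 := fun g => by
    by_cases h : gridPt m g ∈ C <;> simp [hF, h]
  have hmono : Monotone F := by
    intro g g' h
    by_cases hg : gridPt m g ∈ C
    · have hg' := hC (gridPt_mono m h) hg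
      simp [hF, hg, hg']
    · refine le_trans (le_of_eq ?_) (h0 g')
      simp [hF, hg]
  have hms := (measurableSet_levelSet (2 * m) C).diff (measurableSet_levelSet m C)
  have key := integral_osc_le hd hm hmono h0 h1
  rw [one_mul] at key
  refine le_trans ?_ key
  have : (volume : Measure (Cube d)).real (levelSet (2 * m) C \ levelSet m C) =
      ∫ x, (levelSet (2 * m) C \ levelSet m C).indicator (fun _ => (1 : ℝ)) x := by
    rw [integral_indicator hms]; simp
  rw [this]
  refine integral_mono ((integrable_const _).indicator hms)
    (integrable_comp_cellIx m fun g => F (g + 1) - F g) fun x => ?_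
  by_cases hx : x ∈ levelSet (2 * m) C \ levelSet m C
  · have hu : gridPt m (cellIx m x + 1) ∈ C :=
      hC ((gridPt_cellIx_le (2 * m) x).trans (le_gridPt_cellIx hm x)) hx.1
    have hl : gridPt m (cellIx m x) ∉ C := hx.2
    simp [hx, hF, hu, hl]
  · rw [Set.indicator_of_notMem hx]
    exact sub_nonneg.2 (hmono (le_add_of_nonneg_right (by intro i; simp)))

/-- The ratio of the chaining sum. -/
noncomputable def chainRatio : ℝ := 1 / √2

theorem chainRatio_pos : 0 < chainRatio := by unfold chainRatio; positivity

theorem chainRatio_sq : chainRatio ^ 2 = 1 / 2 := by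
  unfold chainRatio
  rw [div_pow, Real.sq_sqrt (by norm_num)]
  norm_num

theorem chainRatio_le_one : chainRatio ≤ 1 := by
  have := chainRatio_sq
  have := chainRatio_pos
  nlinarith

/-- The constant of the chaining bound in dimension `e + 2`. -/
noncomputable def chainConst (e : ℕ) : ℝ := 3 ^ (e + 2) + wBound * ((e + 2 : ℕ) * 4 ^ (e + 2))

theorem chainConst_pos (e : ℕ) : 0 < chainConst e := by
  have := wBound_nonneg
  unfold chainConst
  positivity

/-- The leading factor 2 accounts for the two signs in the maximal inequality. -/
theorem log_two_mul_two_pow_le {e m : ℕ} (hm : 0 < m) :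
    Real.log (2 * 2 ^ (2 * (2 * m + 1) * (2 * m + 1) ^ e)) ≤ 3 ^ (e + 2) * (m : ℝ) ^ (e + 1) := by
  rw [← pow_succ', Real.log_pow]
  have hl : Real.log 2 ≤ 1 := by linarith [Real.log_two_lt_d9]
  have hm1 : (1 : ℝ) ≤ m := by exact_mod_cast hm
  have h1 : (2 * (m : ℝ) + 1) ^ (e + 1) ≤ (3 * m) ^ (e + 1) := by gcongr; linarith
  have h2 : (1 : ℝ) ≤ (3 * m) ^ (e + 1) := one_le_pow₀ (by linarith)
  calc _ ≤ ((2 * (2 * m + 1) * (2 * m + 1) ^ e + 1 : ℕ) : ℝ) * 1 := by gcongr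
    _ = 2 * (2 * (m : ℝ) + 1) ^ (e + 1) + 1 := by push_cast; ring
    _ ≤ 3 * (3 * m) ^ (e + 1) := by linarith
    _ = _ := by rw [mul_pow]; ring

theorem IsWeight.exists_level_envelope {w : ℝ → ℝ} (hw : IsWeight w) {e n K k : ℕ} (hk : k ≤ K)
    (hn : (n : ℝ) ≤ (2 * 2 ^ K) ^ (e + 2)) {𝒟 : Set (Set (Cube (e + 2)))} (hfin : 𝒟.Finite)
    (hcard : 𝒟.ncard ≤ 2 ^ (2 * (2 * 2 ^ k + 1) * (2 * 2 ^ k + 1) ^ e))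
    (hmeas : ∀ D ∈ 𝒟, MeasurableSet D)
    (hv : ∀ D ∈ 𝒟, volume.real D ≤ (e + 2 : ℕ) * 2 ^ (e + 2) / 2 ^ k) :
    ∃ G : (Fin n → Cube (e + 2) × ℝ) → ℝ, Integrable G (sampleLaw (e + 2) n) ∧
      (∫ z, G z ∂(sampleLaw (e + 2) n)) ≤
        chainConst e * (2 ^ (K * (e + 1)) * chainRatio ^ ((K - k) * e)) ∧
      ∀ z, ∀ D ∈ 𝒟, |dev w z (D.indicator fun _ => 1)| ≤ G z := by
  obtain ⟨j, rfl⟩ := Nat.exists_eq_add_of_le hk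
  have hr := chainRatio_pos
  -- With `j = K - k`, this is `t = 2^(-jd/2)`, which balances the entropy `2^(k(d-1))` against `n
  -- t² 2^(-k)` when `n ≈ 2^(Kd)`. It is at most 1, as the exponential moment bound requires.
  have ht0 : 0 < chainRatio ^ (j * (e + 2)) := by positivity
  obtain ⟨G, hG, hGi, hGb⟩ := hw.exists_envelope (n := n) hfin
    (N := 2 ^ (2 * (2 * 2 ^ k + 1) * (2 * 2 ^ k + 1) ^ e)) (by exact_mod_cast hcard)
    (one_le_pow₀ (by norm_num)) hmeas hv ht0 (pow_le_one₀ hr.le chainRatio_le_one)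
  refine ⟨G, hG, hGi.trans ?_, hGb⟩
  rw [div_le_iff₀ ht0]
  have hlog := log_two_mul_two_pow_le (e := e) (m := 2 ^ k) (by positivity)
  push_cast at hlog
  have ht2 : (chainRatio ^ (j * (e + 2))) ^ 2 = (1 / 2 : ℝ) ^ (j * (e + 2)) := by
    rw [← pow_mul, mul_comm, pow_mul, chainRatio_sq]
  have hnt : (n : ℝ) * (chainRatio ^ (j * (e + 2))) ^ 2 ≤ 2 ^ (e + 2) * (2 ^ k) ^ (e + 2) := by
    rw [ht2]
    calc _ ≤ ((2 : ℝ) * 2 ^ (k + j)) ^ (e + 2) * (1 / 2 : ℝ) ^ (j * (e + 2)) := by gcongr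
      _ = (2 * 2 ^ (k + j) * (1 / 2) ^ j) ^ (e + 2) := by rw [pow_mul, ← mul_pow]
      _ = (2 * 2 ^ k) ^ (e + 2) := by
        congr 1
        rw [pow_add, one_div_pow]
        field_simp
      _ = _ := mul_pow _ _ _
  have hM := wBound_nonneg
  have h2 : (n : ℝ) * (chainRatio ^ (j * (e + 2))) ^ 2 * wBound *
      ((e + 2 : ℕ) * 2 ^ (e + 2) / 2 ^ k) ≤ wBound * ((e + 2 : ℕ) * 4 ^ (e + 2)) * (2 ^ k) ^ (e + 1) := by
    calc _ ≤ 2 ^ (e + 2) * (2 ^ k) ^ (e + 2) * wBound * ((e + 2 : ℕ) * 2 ^ (e + 2) / 2 ^ k) := by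
          gcongr
      _ = wBound * ((e + 2 : ℕ) * (2 * 2 : ℝ) ^ (e + 2)) * (2 ^ k) ^ (e + 1) := by
          rw [mul_pow (2 : ℝ) 2, pow_succ ((2 : ℝ) ^ k) (e + 1)]
          field_simp
      _ = _ := by norm_num
  have h3 : (2 : ℝ) ^ ((k + j) * (e + 1)) * chainRatio ^ ((k + j - k) * e) * chainRatio ^ (j * (e + 2)) =
      (2 ^ k) ^ (e + 1) := by
    have : k + j - k = j := by omega
    rw [this, mul_assoc, ← pow_add, show j * e + j * (e + 2) = 2 * (j * (e + 1)) by ring, pow_mul chainRatio,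
      chainRatio_sq, pow_mul, pow_mul, ← mul_pow, pow_add (2 : ℝ) k j, one_div_pow]
    rw [show (2 : ℝ) ^ k * 2 ^ j * (1 / 2 ^ j) = 2 ^ k by field_simp]
  rw [mul_assoc (chainConst e), h3, chainConst, add_mul]
  exact add_le_add hlog h2

theorem dev_add {d n : ℕ} (w : ℝ → ℝ) (z : Fin n → Cube d × ℝ) {φ ψ : Cube d → ℝ}
    (hφ : Integrable φ) (hψ : Integrable ψ) :
    dev w z (fun x => φ x + ψ x) = dev w z φ + dev w z ψ := by
  unfold dev
  rw [integral_add hφ hψ]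
  simp_rw [mul_add, Finset.sum_add_distrib]
  ring

theorem integrable_indicator_levelSet {d : ℕ} (m : ℕ) (C : Set (Cube d)) :
    Integrable ((levelSet m C).indicator fun _ => (1 : ℝ)) :=
  (integrable_const _).indicator (measurableSet_levelSet m C)

theorem dev_levelSet_two_mul {d n m : ℕ} (w : ℝ → ℝ) (z : Fin n → Cube d × ℝ) {C : Set (Cube d)}
    (hC : IsUpperSet C) :
    dev w z ((levelSet (2 * m) C).indicator fun _ => 1) =
      dev w z ((levelSet m C).indicator fun _ => 1) +
      dev w z ((levelSet (2 * m) C \ levelSet m C).indicator fun _ => 1) := by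
  rw [← dev_add w z (integrable_indicator_levelSet m C)
    ((integrable_const _).indicator ((measurableSet_levelSet (2 * m) C).diff (measurableSet_levelSet m C)))]
  congr 1
  funext x
  by_cases h1 : x ∈ levelSet m C
  · have h2 := levelSet_subset_two_mul m hC h1
    simp [h1, h2]
  · by_cases h2 : x ∈ levelSet (2 * m) C <;> simp [h1, h2]

/-- The chaining sum. -/
noncomputable def chainSum (e K : ℕ) : ℝ := ∑ j ∈ Finset.range (K + 1), chainRatio ^ (j * e)

/-- The empirical process over upper sets, discretised at the scale `2^(-K)`. -/
theorem IsWeight.exists_upperSet_envelope {w : ℝ → ℝ} (hw : IsWeight w) {e n K : ℕ}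
    (hn : (n : ℝ) ≤ (2 * 2 ^ K) ^ (e + 2)) :
    ∃ G : (Fin n → Cube (e + 2) × ℝ) → ℝ, Integrable G (sampleLaw (e + 2) n) ∧
      (∫ z, G z ∂(sampleLaw (e + 2) n)) ≤
        2 * chainConst e * 2 ^ (K * (e + 1)) * chainSum e K ∧
      ∀ z, ∀ C, IsUpperSet C → |dev w z ((levelSet (2 ^ K) C).indicator fun _ => 1)| ≤ G z := by
  have hinc : ∀ k < K, ∃ G : (Fin n → Cube (e + 2) × ℝ) → ℝ, Integrable G (sampleLaw (e + 2) n) ∧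
      (∫ z, G z ∂(sampleLaw (e + 2) n)) ≤
        chainConst e * (2 ^ (K * (e + 1)) * chainRatio ^ ((K - k) * e)) ∧
      ∀ z, ∀ D ∈ {D : Set (Cube (e + 2)) | ∃ C, IsUpperSet C ∧
        D = levelSet (2 * 2 ^ k) C \ levelSet (2 ^ k) C},
        |dev w z (D.indicator fun _ => 1)| ≤ G z := by
    intro k hk
    refine hw.exists_level_envelope hk.le hn (increment_family (2 ^ k)).1 (increment_family (2 ^ k)).2 ?_ ?_
    · rintro D ⟨C, hC, rfl⟩
      exact (measurableSet_levelSet _ C).diff (measurableSet_levelSet _ C)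
    · rintro D ⟨C, hC, rfl⟩
      have := volume_increment_le (d := e + 2) (by omega) (m := 2 ^ k) (by positivity) hC
      exact_mod_cast this
  -- The chain starts at mesh 1, where the trivial volume bound 1 suffices because `d * 2^d ≥ 1`.
  obtain ⟨G₀, hG₀, hG₀i, hG₀b⟩ := hw.exists_level_envelope (Nat.zero_le K) hn
    (levelSet_family (e := e) 1).1 ((levelSet_family (e := e) 1).2.trans (by
      gcongr <;> norm_num)) (by
      rintro D ⟨C, hC, rfl⟩
      exact measurableSet_levelSet _ C) (by
      rintro D ⟨C, hC, rfl⟩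
      refine measureReal_le_one.trans ?_
      rw [pow_zero, div_one]
      refine one_le_mul_of_one_le_of_one_le ?_ (one_le_pow₀ (by norm_num))
      exact_mod_cast (by omega : 1 ≤ e + 2))
  choose! G hG hGi hGb using hinc
  have hr := chainRatio_pos
  have hcc := chainConst_pos e
  refine ⟨fun z => G₀ z + ∑ k ∈ Finset.range K, G k z, ?_, ?_, ?_⟩
  · exact hG₀.add (integrable_finsetSum _ fun k hk => hG k (Finset.mem_range.1 hk))
  · rw [integral_add hG₀ (integrable_finsetSum _ fun k hk => hG k (Finset.mem_range.1 hk)),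
      integral_finsetSum _ fun k hk => hG k (Finset.mem_range.1 hk)]
    have h1 : ∑ k ∈ Finset.range K, ∫ z, G k z ∂(sampleLaw (e + 2) n) ≤
        chainConst e * 2 ^ (K * (e + 1)) * chainSum e K := by
      calc _ ≤ ∑ k ∈ Finset.range K, chainConst e * (2 ^ (K * (e + 1)) * chainRatio ^ ((K - k) * e)) :=
            Finset.sum_le_sum fun k hk => hGi k (Finset.mem_range.1 hk)
        _ = chainConst e * 2 ^ (K * (e + 1)) * ∑ k ∈ Finset.range K, chainRatio ^ ((K - k) * e) := by
            rw [Finset.mul_sum]; exact Finset.sum_congr rfl fun _ _ => by ring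
        _ ≤ _ := by
            refine mul_le_mul_of_nonneg_left ?_ (by positivity)
            rw [← Finset.sum_range_reflect, chainSum, Finset.sum_range_succ']
            refine le_add_of_le_of_nonneg (Finset.sum_le_sum fun k hk => le_of_eq ?_) (by positivity)
            have := Finset.mem_range.1 hk
            congr 2
            omega
    -- The starting term is bounded by a second copy of `chainSum`, whence the factor 2.
    have h2 : chainRatio ^ ((K - 0) * e) ≤ chainSum e K := by
      rw [Nat.sub_zero]
      exact Finset.single_le_sum (f := fun j => chainRatio ^ (j * e)) (fun j _ => by positivity)
        (Finset.self_mem_range_succ K)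
    have h3 := mul_le_mul_of_nonneg_left h2 (by positivity : 0 ≤ chainConst e * 2 ^ (K * (e + 1)))
    linarith
  · intro z C hC
    have h : ∀ k ≤ K, |dev w z ((levelSet (2 ^ k) C).indicator fun _ => 1)| ≤
        G₀ z + ∑ i ∈ Finset.range k, G i z := by
      intro k
      induction k with
      | zero =>
        intro _
        simpa using hG₀b z _ ⟨C, hC, rfl⟩
      | succ k ih =>
        intro hk
        rw [pow_succ', dev_levelSet_two_mul w z hC, Finset.sum_range_succ, ← add_assoc]
        exact (abs_add_le _ _).trans (add_le_add (ih (by omega)) (hGb k (by omega) z _ ⟨C, hC, rfl⟩))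
    exact h K le_rfl

/-! ### From upper sets to monotone functions -/

/-- Layer cake: `F g` is the integral over `t ∈ [0, 1]` of the indicator of `t < F g`, so the sum is
an average of sums over superlevel sets. -/
theorem abs_sum_mul_le_of_superlevel {ι : Type*} (s : Finset ι) (θ F : ι → ℝ) {S : ℝ}
    (h0 : ∀ g, 0 ≤ F g) (h1 : ∀ g, F g ≤ 1)
    (h : ∀ t : ℝ, |∑ g ∈ s, θ g * (Set.Iio (F g)).indicator (fun _ => (1 : ℝ)) t| ≤ S) :
    |∑ g ∈ s, θ g * F g| ≤ S := by
  have hF : ∀ g, ∫ t in (0 : ℝ)..1, (Set.Iio (F g)).indicator (fun _ => (1 : ℝ)) t = F g := by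
    intro g
    rw [intervalIntegral.integral_of_le zero_le_one, integral_Ioc_eq_integral_Ioo,
      integral_indicator measurableSet_Iio, Measure.restrict_restrict measurableSet_Iio]
    have : Set.Iio (F g) ∩ Set.Ioo 0 1 = Set.Ioo 0 (F g) := by
      ext t
      simp only [Set.mem_inter_iff, Set.mem_Iio, Set.mem_Ioo]
      constructor
      · rintro ⟨a, b, c⟩; exact ⟨b, a⟩
      · rintro ⟨a, b⟩; exact ⟨b, a, b.trans_le (h1 g)⟩
    rw [this]
    simp [h0 g]
  have hI : ∀ g, IntervalIntegrable (fun t => (Set.Iio (F g)).indicator (fun _ => (1 : ℝ)) t)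
      volume 0 1 := by
    intro g
    rw [intervalIntegrable_iff, Set.uIoc_of_le zero_le_one]
    exact (integrable_const (1 : ℝ)).indicator measurableSet_Iio
  have : ∑ g ∈ s, θ g * F g =
      ∫ t in (0 : ℝ)..1, ∑ g ∈ s, θ g * (Set.Iio (F g)).indicator (fun _ => (1 : ℝ)) t := by
    rw [intervalIntegral.integral_finsetSum fun g _ => (hI g).const_mul (θ g)]
    refine Finset.sum_congr rfl fun g _ => ?_
    rw [intervalIntegral.integral_const_mul, hF]
  rw [this]
  have := intervalIntegral.norm_integral_le_of_norm_le_const (a := (0 : ℝ)) (b := 1) (C := S)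
    (f := fun t => ∑ g ∈ s, θ g * (Set.Iio (F g)).indicator (fun _ => (1 : ℝ)) t) (fun t _ => h t)
  simpa using this

/-- The coefficients of the empirical process in terms of the cells. -/
theorem dev_comp_cellIx {d n : ℕ} (w : ℝ → ℝ) (z : Fin n → Cube d × ℝ) (m : ℕ) :
    ∃ θ : (Fin d → ℕ) → ℝ, ∀ F : (Fin d → ℕ) → ℝ,
      dev w z (fun x => F (cellIx m x)) = ∑ g ∈ gridIx d m, θ g * F g := by
  classical
  refine ⟨fun g => (∑ i, w (z i).2 * if cellIx m (z i).1 = g then 1 else 0) -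
    n * wMean w * cellMass d m g, fun F => ?_⟩
  rw [dev, integral_comp_cellIx]
  simp_rw [sub_mul]
  rw [Finset.sum_sub_distrib, Finset.mul_sum]
  congr 1
  · simp_rw [Finset.sum_mul]
    rw [Finset.sum_comm]
    refine Finset.sum_congr rfl fun i _ => ?_
    rw [Finset.sum_eq_single (cellIx m (z i).1)]
    · simp
    · intro g _ hg
      simp [hg.symm]
    · intro h
      exact absurd (cellIx_mem m _) h
  · exact Finset.sum_congr rfl fun _ _ => by ring

/-- Superlevel sets of `f` are upper sets. The discretised process is a finite linear form in the
grid values, so no measurability of `f` is needed. -/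
theorem abs_dev_monotone_le_one {d n m : ℕ} {w : ℝ → ℝ} {z : Fin n → Cube d × ℝ} {S : ℝ}
    (hS : ∀ C, IsUpperSet C → |dev w z ((levelSet m C).indicator fun _ => 1)| ≤ S)
    {f : Cube d → ℝ} (hf : Monotone f) (h0 : ∀ x, 0 ≤ f x) (h1 : ∀ x, f x ≤ 1) :
    |dev w z (fun x => f (gridPt m (cellIx m x)))| ≤ S := by
  obtain ⟨θ, hθ⟩ := dev_comp_cellIx w z m
  rw [hθ fun g => f (gridPt m g)]
  refine abs_sum_mul_le_of_superlevel _ θ _ (fun g => h0 _) (fun g => h1 _) fun t => ?_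
  have hC : IsUpperSet {x | t < f x} := fun x y hxy hx => lt_of_lt_of_le hx (hf hxy)
  have := hS _ hC
  have e : dev w z ((levelSet m {x | t < f x}).indicator fun _ => 1) =
      ∑ g ∈ gridIx d m, θ g * (Set.Iio (f (gridPt m g))).indicator (fun _ => (1 : ℝ)) t := by
    rw [← hθ fun g => (Set.Iio (f (gridPt m g))).indicator (fun _ => (1 : ℝ)) t]
    congr 1
  rwa [e] at this

theorem dev_const_mul {d n : ℕ} (w : ℝ → ℝ) (z : Fin n → Cube d × ℝ) (c : ℝ) (φ : Cube d → ℝ) :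
    dev w z (fun x => c * φ x) = c * dev w z φ := by
  unfold dev
  rw [integral_const_mul, mul_sub, Finset.mul_sum]
  congr 1
  · exact Finset.sum_congr rfl fun _ _ => by ring
  · ring

theorem abs_dev_monotone_le {d n m : ℕ} {w : ℝ → ℝ} {z : Fin n → Cube d × ℝ} {S : ℝ}
    (hS : ∀ C, IsUpperSet C → |dev w z ((levelSet m C).indicator fun _ => 1)| ≤ S)
    {f : Cube d → ℝ} (hf : Monotone f) {H : ℝ} (hH : 0 < H) (h0 : ∀ x, 0 ≤ f x) (h1 : ∀ x, f x ≤ H) :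
    |dev w z (fun x => f (gridPt m (cellIx m x)))| ≤ H * S := by
  have := abs_dev_monotone_le_one hS (f := fun x => H⁻¹ * f x)
    (fun x y h => mul_le_mul_of_nonneg_left (hf h) (by positivity))
    (fun x => mul_nonneg (by positivity) (h0 x))
    (fun x => by rw [inv_mul_le_iff₀ hH, mul_one]; exact h1 x)
  rw [dev_const_mul w z H⁻¹ fun x => f (gridPt m (cellIx m x)), abs_mul, abs_of_pos (by positivity),
    inv_mul_le_iff₀ hH] at this
  exact this

/-- Shifting by `1/m` along the diagonal, clipped to the cube. -/
noncomputable def shift {d : ℕ} (m : ℕ) (x : Cube d) : Cube d := fun i =>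
  ⟨min ((x i : ℝ) + 1 / m) 1, le_min (add_nonneg (x i).2.1 (by positivity)) zero_le_one,
    min_le_right _ _⟩

theorem shift_mono {d : ℕ} (m : ℕ) : Monotone (shift (d := d) m) := by
  intro x y h i
  have : (x i : ℝ) ≤ y i := h i
  exact Subtype.mk_le_mk.2 (min_le_min_right _ (by linarith))

/-- Makes the upper-corner discretisation of `f` the lower-corner one of the monotone function `f ∘
shift m`, so a single bound serves both. -/
theorem gridPt_add_one {d : ℕ} (m : ℕ) (g : Fin d → ℕ) :
    gridPt m (g + 1) = shift m (gridPt m g) := by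
  funext i
  apply Subtype.ext
  simp only [gridPt, shift, Pi.add_apply, Pi.one_apply]
  have h : (0 : ℝ) ≤ 1 / m := by positivity
  rcases le_total ((g i : ℝ) / m) 1 with h1 | h1
  · rw [min_eq_left h1]
    push_cast
    rw [add_div]
  · rw [min_eq_right h1, min_eq_right (by linarith : (1 : ℝ) ≤ 1 + 1 / m), min_eq_right]
    push_cast
    rw [add_div]
    linarith

theorem integrable_comp_lower {d : ℕ} (m : ℕ) (f : Cube d → ℝ) :
    Integrable fun x => f (gridPt m (cellIx m x)) :=
  integrable_comp_cellIx m fun g => f (gridPt m g)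

theorem integrable_comp_upper {d : ℕ} (m : ℕ) (f : Cube d → ℝ) :
    Integrable fun x => f (gridPt m (cellIx m x + 1)) :=
  integrable_comp_cellIx m fun g => f (gridPt m (g + 1))

theorem integral_upper_sub_lower_le {d m : ℕ} (hd : 1 ≤ d) (hm : 0 < m) {f : Cube d → ℝ}
    (hf : Monotone f) {H : ℝ} (h0 : ∀ x, 0 ≤ f x) (h1 : ∀ x, f x ≤ H) :
    ∫ x, (f (gridPt m (cellIx m x + 1)) - f (gridPt m (cellIx m x))) ≤ H * (d * 2 ^ d / m) :=
  integral_osc_le hd hm (F := fun g => f (gridPt m g)) (hf.comp (gridPt_mono m)) (fun _ => h0 _)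
    fun _ => h1 _

/-- The weighted sums of a bounded monotone function concentrate around the mean of its lower
discretisation. -/
theorem abs_sum_sub_integral_lower_le {d n m : ℕ} (hd : 1 ≤ d) (hm : 0 < m) {w : ℝ → ℝ}
    (hw : IsWeight w) {z : Fin n → Cube d × ℝ} {S : ℝ}
    (hS : ∀ C, IsUpperSet C → |dev w z ((levelSet m C).indicator fun _ => 1)| ≤ S)
    {f : Cube d → ℝ} (hf : Monotone f) {H : ℝ} (hH : 0 < H) (h0 : ∀ x, 0 ≤ f x) (h1 : ∀ x, f x ≤ H) :
    |∑ i, w (z i).2 * f (z i).1 - n * wMean w * ∫ x, f (gridPt m (cellIx m x))| ≤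
      H * (S + n * (wBound * (d * 2 ^ d / m))) := by
  have hlo := abs_le.1 (abs_dev_monotone_le hS hf hH h0 h1)
  have hup := abs_le.1 (abs_dev_monotone_le hS (f := fun x => f (shift m x)) (hf.comp (shift_mono m)) hH
    (fun x => h0 _) (fun x => h1 _))
  simp only [dev] at hlo hup
  simp_rw [← gridPt_add_one] at hup
  have hosc := integral_upper_sub_lower_le hd hm hf h0 h1
  rw [integral_sub (integrable_comp_upper m f) (integrable_comp_lower m f)] at hosc
  -- Bracketing inside the sum is legitimate only because the weights are nonnegative; this is why
  -- the noise is split by sign.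
  have hlow : ∑ i, w (z i).2 * f (gridPt m (cellIx m (z i).1)) ≤ ∑ i, w (z i).2 * f (z i).1 :=
    Finset.sum_le_sum fun i _ => mul_le_mul_of_nonneg_left (hf (gridPt_cellIx_le m _)) (hw.nonneg _)
  have hupp : ∑ i, w (z i).2 * f (z i).1 ≤ ∑ i, w (z i).2 * f (gridPt m (cellIx m (z i).1 + 1)) :=
    Finset.sum_le_sum fun i _ => mul_le_mul_of_nonneg_left (hf (le_gridPt_cellIx hm _)) (hw.nonneg _)
  have hn0 : (0 : ℝ) ≤ n := Nat.cast_nonneg n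
  have ha := hw.mean_nonneg
  have haB := hw.mean_le
  have hq : (0 : ℝ) ≤ d * 2 ^ d / m := by positivity
  have h2 : (n : ℝ) * wMean w * (∫ x, f (gridPt m (cellIx m x + 1))) -
      n * wMean w * (∫ x, f (gridPt m (cellIx m x))) ≤ H * (n * (wBound * (d * 2 ^ d / m))) := by
    rw [← mul_sub]
    calc _ ≤ n * wMean w * (H * (d * 2 ^ d / m)) := by gcongr
      _ ≤ n * wBound * (H * (d * 2 ^ d / m)) := by gcongr
      _ = _ := by ring
  have h3 : 0 ≤ H * (n * (wBound * (d * 2 ^ d / m))) := by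
    have := wBound_nonneg
    positivity
  rw [abs_le]
  constructor <;> linarith [hlo.1, hlo.2, hup.1, hup.2]

/-! ### Deterministic analysis of the least squares estimator -/

/-- Clipping at `±B` keeps monotonicity and brings any fitted value outside `[-B, B]` strictly
closer to its observation, contradicting minimality. The `range` field carries the bound from the
design points to the cube. -/
theorem IsIsotonicLSE.abs_le {d n : ℕ} {X : Fin n → Cube d} {Y : Fin n → ℝ} {f : Cube d → ℝ}
    (hf : IsIsotonicLSE X Y f) {B : ℝ} (hY : ∀ i, |Y i| ≤ B) (x : Cube d) : |f x| ≤ B := by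
  have hfit : ∀ i, |f (X i)| ≤ B := by
    by_contra hcon
    push Not at hcon
    obtain ⟨i₀, hi₀⟩ := hcon
    let g : Cube d → ℝ := fun x => max (-B) (min (f x) B)
    have hg : g ∈ isotonicClass d := fun x y hxy =>
      max_le_max_left _ (min_le_min_right _ (hf.isotonic x y hxy))
    have hle : ∀ i, (Y i - g (X i)) ^ 2 ≤ (Y i - f (X i)) ^ 2 ∧
        (B < |f (X i)| → (Y i - g (X i)) ^ 2 < (Y i - f (X i)) ^ 2) := by
      intro i
      have h1 := _root_.abs_le.1 (hY i)
      have hB : -B ≤ B := h1.1.trans h1.2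
      simp only [g]
      rcases le_total (f (X i)) B with h2 | h2
      · rw [min_eq_left h2]
        rcases le_total (-B) (f (X i)) with h3 | h3
        · rw [max_eq_right h3]
          exact ⟨le_rfl, fun h => absurd (_root_.abs_le.2 ⟨h3, h2⟩) (not_le.2 h)⟩
        · rw [max_eq_left h3]
          refine ⟨by nlinarith, fun h => ?_⟩
          have h4 : f (X i) < -B := by
            rcases abs_choice (f (X i)) with h' | h' <;> rw [h'] at h <;> linarith
          nlinarith
      · rw [min_eq_right h2, max_eq_right hB]
        refine ⟨by nlinarith, fun h => ?_⟩
        have h4 : B < f (X i) := by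
          rcases abs_choice (f (X i)) with h' | h' <;> rw [h'] at h <;> linarith
        nlinarith
    have hlt : rss X Y g < rss X Y f :=
      Finset.sum_lt_sum (fun i _ => (hle i).1) ⟨i₀, Finset.mem_univ _, (hle i₀).2 hi₀⟩
    exact absurd (hf.minimal g hg) (not_le.2 hlt)
  obtain ⟨⟨i, hi⟩, ⟨j, hj⟩⟩ := hf.range x
  have h1 := _root_.abs_le.1 (hfit i)
  have h2 := _root_.abs_le.1 (hfit j)
  exact _root_.abs_le.2 ⟨by linarith, by linarith⟩

theorem isWeight_one : IsWeight fun _ => 1 where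
  meas := measurable_const
  nonneg _ := zero_le_one
  le z := by linarith [abs_nonneg z]

theorem isWeight_posPart : IsWeight fun z => max z 0 where
  meas := measurable_id.max measurable_const
  nonneg _ := le_max_right _ _
  le z := max_le (by linarith [le_abs_self z]) (by linarith [abs_nonneg z])

theorem isWeight_negPart : IsWeight fun z => max (-z) 0 where
  meas := measurable_neg.max measurable_const
  nonneg _ := le_max_right _ _
  le z := max_le (by linarith [neg_le_abs z]) (by linarith [abs_nonneg z])

theorem max_sub_max_neg (z : ℝ) : max z 0 - max (-z) 0 = z := by
  rcases le_total z 0 with h | h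
  · rw [max_eq_right h, max_eq_left (by linarith)]; ring
  · rw [max_eq_left h, max_eq_right (by linarith)]; ring

theorem wMean_one : wMean (fun _ => 1) = 1 := by simp [wMean]

/-- The noise has mean zero; hence the mean terms of the two signed parts cancel in
`sum_noise_mul_sub_le`. -/
theorem wMean_posPart_eq : wMean (fun z => max z 0) = wMean (fun z => max (-z) 0) := by
  refine sub_eq_zero.1 ?_
  unfold wMean
  rw [← integral_sub isWeight_posPart.integrable isWeight_negPart.integrable]
  simp_rw [max_sub_max_neg]
  exact integral_id_gaussianReal

/-- A bound for the weighted empirical process over upper sets, discretised on the grid. -/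
def DevBound {d n : ℕ} (w : ℝ → ℝ) (m : ℕ) (z : Fin n → Cube d × ℝ) (S : ℝ) : Prop :=
  ∀ C, IsUpperSet C → |dev w z ((levelSet m C).indicator fun _ => 1)| ≤ S

theorem sum_noise_mul_sub_le {d n m : ℕ} (hd : 1 ≤ d) (hm : 0 < m) {z : Fin n → Cube d × ℝ}
    {Sp Sm : ℝ} (hp : DevBound (fun z => max z 0) m z Sp) (hn : DevBound (fun z => max (-z) 0) m z Sm)
    {p q : Cube d → ℝ} (hpm : Monotone p) (hqm : Monotone q) {H : ℝ} (hH : 0 < H)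
    (hp0 : ∀ x, 0 ≤ p x) (hp1 : ∀ x, p x ≤ H) (hq0 : ∀ x, 0 ≤ q x) (hq1 : ∀ x, q x ≤ H) :
    ∑ i, (z i).2 * (p (z i).1 - q (z i).1) ≤
      2 * (H * (Sp + Sm + 2 * (n * (wBound * (d * 2 ^ d / m))))) := by
  have hsplit : ∑ i, (z i).2 * (p (z i).1 - q (z i).1) =
      ((∑ i, max (z i).2 0 * p (z i).1) - ∑ i, max (-(z i).2) 0 * p (z i).1) -
      ((∑ i, max (z i).2 0 * q (z i).1) - ∑ i, max (-(z i).2) 0 * q (z i).1) := by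
    simp_rw [← Finset.sum_sub_distrib, ← sub_mul, max_sub_max_neg]
    exact Finset.sum_congr rfl fun i _ => by ring
  have a1 := abs_le.1 (abs_sum_sub_integral_lower_le hd hm isWeight_posPart hp hpm hH hp0 hp1)
  have a2 := abs_le.1 (abs_sum_sub_integral_lower_le hd hm isWeight_negPart hn hpm hH hp0 hp1)
  have a3 := abs_le.1 (abs_sum_sub_integral_lower_le hd hm isWeight_posPart hp hqm hH hq0 hq1)
  have a4 := abs_le.1 (abs_sum_sub_integral_lower_le hd hm isWeight_negPart hn hqm hH hq0 hq1)
  rw [wMean_posPart_eq] at a1 a3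
  rw [hsplit]
  linarith [a1.1, a1.2, a2.1, a2.2, a3.1, a3.2, a4.1, a4.2]

/-- `(p - q)²` is not monotone, but `p²`, `pq` and `q²` are, as products of nonnegative monotone
functions. Their coefficients 1, 2, 1 give the factor 4. -/
theorem integral_sq_lower_le {d n m : ℕ} (hd : 1 ≤ d) (hm : 0 < m) {z : Fin n → Cube d × ℝ}
    {S : ℝ} (hS : DevBound (fun _ => 1) m z S)
    {p q : Cube d → ℝ} (hpm : Monotone p) (hqm : Monotone q) {H : ℝ} (hH : 0 < H)
    (hp0 : ∀ x, 0 ≤ p x) (hp1 : ∀ x, p x ≤ H) (hq0 : ∀ x, 0 ≤ q x) (hq1 : ∀ x, q x ≤ H) :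
    n * ∫ x, (p (gridPt m (cellIx m x)) - q (gridPt m (cellIx m x))) ^ 2 ≤
      ∑ i, (p (z i).1 - q (z i).1) ^ 2 + 4 * (H ^ 2 * (S + n * (wBound * (d * 2 ^ d / m)))) := by
  have hmul : ∀ {a b : Cube d → ℝ}, Monotone a → Monotone b → (∀ x, 0 ≤ a x) → (∀ x, a x ≤ H) →
      (∀ x, 0 ≤ b x) → (∀ x, b x ≤ H) →
      |∑ i, a (z i).1 * b (z i).1 - n * ∫ x, a (gridPt m (cellIx m x)) * b (gridPt m (cellIx m x))| ≤
        H ^ 2 * (S + n * (wBound * (d * 2 ^ d / m))) := by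
    intro a b ha hb ha0 ha1 hb0 hb1
    have := abs_sum_sub_integral_lower_le hd hm isWeight_one hS (f := fun x => a x * b x)
      (fun x y h => mul_le_mul (ha h) (hb h) (hb0 _) (ha0 _)) (pow_pos hH 2)
      (fun x => mul_nonneg (ha0 x) (hb0 x))
      (fun x => by rw [sq]; exact mul_le_mul (ha1 x) (hb1 x) (hb0 x) hH.le)
    simpa only [wMean_one, one_mul, mul_one] using this
  have a1 := abs_le.1 (hmul hpm hpm hp0 hp1 hp0 hp1)
  have a2 := abs_le.1 (hmul hpm hqm hp0 hp1 hq0 hq1)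
  have a3 := abs_le.1 (hmul hqm hqm hq0 hq1 hq0 hq1)
  have i1 := integrable_comp_lower m fun x => p x * p x
  have i2 := (integrable_comp_lower m fun x => p x * q x).const_mul 2
  have i3 := integrable_comp_lower m fun x => q x * q x
  have e1 : ∫ x, (p (gridPt m (cellIx m x)) - q (gridPt m (cellIx m x))) ^ 2 =
      (∫ x, p (gridPt m (cellIx m x)) * p (gridPt m (cellIx m x))) -
      2 * (∫ x, p (gridPt m (cellIx m x)) * q (gridPt m (cellIx m x))) +
      ∫ x, q (gridPt m (cellIx m x)) * q (gridPt m (cellIx m x)) := by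
    have i4 : Integrable fun x => p (gridPt m (cellIx m x)) * p (gridPt m (cellIx m x)) -
        2 * (p (gridPt m (cellIx m x)) * q (gridPt m (cellIx m x))) := i1.sub i2
    rw [← integral_const_mul, ← integral_sub i1 i2, ← integral_add i4 i3]
    exact integral_congr_ae (Filter.Eventually.of_forall fun x => by ring)
  have e2 : ∑ i, (p (z i).1 - q (z i).1) ^ 2 = ∑ i, p (z i).1 * p (z i).1 -
      2 * ∑ i, p (z i).1 * q (z i).1 + ∑ i, q (z i).1 * q (z i).1 := by
    rw [Finset.mul_sum, ← Finset.sum_sub_distrib, ← Finset.sum_add_distrib]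
    exact Finset.sum_congr rfl fun i _ => by ring
  rw [e1, e2]
  linarith [a1.1, a1.2, a2.1, a2.2, a3.1, a3.2]

/-- Difference of squares: the sum factor is at most `2 * H`, and the difference factor is at most
the oscillations of `p` and `q` over the cell. -/
theorem sqL2Dist_le_integral_lower {d m : ℕ} (hd : 1 ≤ d) (hm : 0 < m)
    {p q : Cube d → ℝ} (hpm : Monotone p) (hqm : Monotone q) {H : ℝ}
    (hp0 : ∀ x, 0 ≤ p x) (hp1 : ∀ x, p x ≤ H) (hq0 : ∀ x, 0 ≤ q x) (hq1 : ∀ x, q x ≤ H) :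
    sqL2Dist p q ≤ ENNReal.ofReal
      ((∫ x, (p (gridPt m (cellIx m x)) - q (gridPt m (cellIx m x))) ^ 2) +
        4 * (H ^ 2 * (d * 2 ^ d / m))) := by
  have hH : 0 ≤ H := (hp0 0).trans (hp1 0)
  set osc : (Cube d → ℝ) → Cube d → ℝ := fun f x =>
    f (gridPt m (cellIx m x + 1)) - f (gridPt m (cellIx m x)) with hosc
  have io : ∀ f, Integrable (osc f) := fun f =>
    (integrable_comp_upper m f).sub (integrable_comp_lower m f)
  have osc_nonneg : ∀ {f}, Monotone f → ∀ x, 0 ≤ osc f x := fun hf x =>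
    sub_nonneg.2 (hf ((gridPt_cellIx_le m x).trans (le_gridPt_cellIx hm x)))
  have i1 := integrable_comp_lower m fun x => (p x - q x) ^ 2
  have i2 : Integrable fun x => 2 * H * (osc p x + osc q x) := ((io p).add (io q)).const_mul _
  have i3 : Integrable fun x => (p (gridPt m (cellIx m x)) - q (gridPt m (cellIx m x))) ^ 2 +
      2 * H * (osc p x + osc q x) := i1.add i2
  have hpt : ∀ x, (p x - q x) ^ 2 ≤ (p (gridPt m (cellIx m x)) - q (gridPt m (cellIx m x))) ^ 2 +
      2 * H * (osc p x + osc q x) := by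
    intro x
    have lp := hpm (gridPt_cellIx_le m x)
    have up := hpm (le_gridPt_cellIx hm x)
    have lq := hqm (gridPt_cellIx_le m x)
    have uq := hqm (le_gridPt_cellIx hm x)
    simp only [hosc]
    set y := gridPt m (cellIx m x)
    set u := gridPt m (cellIx m x + 1)
    have b1 : |(p x - q x) - (p y - q y)| ≤ (p u - p y) + (q u - q y) :=
      abs_le.2 ⟨by linarith, by linarith⟩
    have b2 : |(p x - q x) + (p y - q y)| ≤ 2 * H :=
      abs_le.2 ⟨by linarith [hp0 x, hp0 y, hq1 x, hq1 y], by linarith [hp1 x, hp1 y, hq0 x, hq0 y]⟩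
    have b3 : (p x - q x) ^ 2 - (p y - q y) ^ 2 ≤ 2 * H * ((p u - p y) + (q u - q y)) := by
      calc _ = ((p x - q x) + (p y - q y)) * ((p x - q x) - (p y - q y)) := by ring
        _ ≤ |((p x - q x) + (p y - q y)) * ((p x - q x) - (p y - q y))| := le_abs_self _
        _ = |(p x - q x) + (p y - q y)| * |(p x - q x) - (p y - q y)| := abs_mul _ _
        _ ≤ _ := by gcongr
    linarith
  calc sqL2Dist p q ≤ ∫⁻ x, ENNReal.ofReal ((p (gridPt m (cellIx m x)) - q (gridPt m (cellIx m x))) ^ 2 +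
      2 * H * (osc p x + osc q x)) := lintegral_mono fun x => ENNReal.ofReal_le_ofReal (hpt x)
    _ = ENNReal.ofReal (∫ x, ((p (gridPt m (cellIx m x)) - q (gridPt m (cellIx m x))) ^ 2 +
      2 * H * (osc p x + osc q x))) := by
        rw [ofReal_integral_eq_lintegral_ofReal i3]
        refine Filter.Eventually.of_forall fun x => ?_
        have := osc_nonneg hpm x
        have := osc_nonneg hqm x
        simp only [Pi.zero_apply]
        positivity
    _ ≤ _ := by
        refine ENNReal.ofReal_le_ofReal ?_
        rw [integral_add i1 i2, integral_const_mul, integral_add (io p) (io q)]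
        have h1 := integral_upper_sub_lower_le hd hm hpm hp0 hp1
        have h2 := integral_upper_sub_lower_le hd hm hqm hq0 hq1
        have h3 := mul_le_mul_of_nonneg_left (add_le_add h1 h2) (by positivity : 0 ≤ 2 * H)
        simp only [hosc]
        linarith

/-- The loss of a least squares estimator is controlled by the empirical processes indexed by
upper sets. -/
theorem IsIsotonicLSE.sqL2Dist_le {d n m : ℕ} (hd : 1 ≤ d) (hm : 0 < m) (hn : 0 < n)
    {z : Fin n → Cube d × ℝ} {S Sp Sm : ℝ} (hS : DevBound (fun _ => 1) m z S)
    (hSp : DevBound (fun z => max z 0) m z Sp) (hSm : DevBound (fun z => max (-z) 0) m z Sm)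
    {f₀ f : Cube d → ℝ} (hf₀ : f₀ ∈ isotonicClass d) {B : ℝ} (hB : 1 ≤ B)
    (hf₀B : ∀ x, |f₀ x| ≤ B) (hY : ∀ i, |f₀ (z i).1 + (z i).2| ≤ B)
    (hf : IsIsotonicLSE (fun i => (z i).1) (fun i => f₀ (z i).1 + (z i).2) f) :
    sqL2Dist f f₀ ≤ ENNReal.ofReal
      (16 * B ^ 2 * ((S + Sp + Sm) / n + (2 * wBound + 1) * (d * 2 ^ d / m))) := by
  have hfB := hf.abs_le hY
  have hn' : (0 : ℝ) < n := by exact_mod_cast hn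
  -- Adding `B` to both functions leaves their difference unchanged and makes them nonnegative, with
  -- range in `[0, 2B]`.
  set p : Cube d → ℝ := fun x => f x + B with hp
  set q : Cube d → ℝ := fun x => f₀ x + B with hq
  have hH : 0 < 2 * B := by linarith
  have hpm : Monotone p := fun x y h => by simpa [hp] using hf.isotonic x y h
  have hqm : Monotone q := fun x y h => by simpa [hq] using hf₀ x y h
  have hp0 : ∀ x, 0 ≤ p x := fun x => by have := (_root_.abs_le.1 (hfB x)).1; simp only [hp]; linarith
  have hp1 : ∀ x, p x ≤ 2 * B := fun x => by have := (_root_.abs_le.1 (hfB x)).2; simp only [hp]; linarith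
  have hq0 : ∀ x, 0 ≤ q x := fun x => by have := (_root_.abs_le.1 (hf₀B x)).1; simp only [hq]; linarith
  have hq1 : ∀ x, q x ≤ 2 * B := fun x => by have := (_root_.abs_le.1 (hf₀B x)).2; simp only [hq]; linarith
  have hpq : ∀ x, p x - q x = f x - f₀ x := fun x => by simp [hp, hq]
  have hdist : sqL2Dist f f₀ = sqL2Dist p q := by
    unfold sqL2Dist
    simp_rw [hpq]
  -- The basic inequality: `f₀` is itself a competitor in the least squares problem.
  have hbasic : ∑ i, (p (z i).1 - q (z i).1) ^ 2 ≤ 2 * ∑ i, (z i).2 * (p (z i).1 - q (z i).1) := by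
    have h := hf.minimal f₀ hf₀
    unfold rss at h
    have e : ∑ i, (f₀ (z i).1 + (z i).2 - f (z i).1) ^ 2 =
        ∑ i, (f₀ (z i).1 + (z i).2 - f₀ (z i).1) ^ 2 + ∑ i, (p (z i).1 - q (z i).1) ^ 2 -
          2 * ∑ i, (z i).2 * (p (z i).1 - q (z i).1) := by
      rw [Finset.mul_sum, ← Finset.sum_add_distrib, ← Finset.sum_sub_distrib]
      refine Finset.sum_congr rfl fun i _ => ?_
      rw [hpq]
      ring
    linarith
  have h1 := sum_noise_mul_sub_le hd hm hSp hSm hpm hqm hH hp0 hp1 hq0 hq1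
  have h2 := integral_sq_lower_le hd hm hS hpm hqm hH hp0 hp1 hq0 hq1
  rw [hdist]
  refine (sqL2Dist_le_integral_lower hd hm hpm hqm hp0 hp1 hq0 hq1).trans (ENNReal.ofReal_le_ofReal ?_)
  set I := ∫ x, (p (gridPt m (cellIx m x)) - q (gridPt m (cellIx m x))) ^ 2
  set Q : ℝ := d * 2 ^ d / m
  have hQ : 0 ≤ Q := by positivity
  have hM := wBound_nonneg
  have hSp0 : 0 ≤ Sp := (abs_nonneg _).trans (hSp ∅ isUpperSet_empty)
  have hSm0 : 0 ≤ Sm := (abs_nonneg _).trans (hSm ∅ isUpperSet_empty)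
  -- Absorbs the noise term, linear in the range, into the quadratic terms.
  have hBB : B ≤ B ^ 2 := by nlinarith
  have hT : 0 ≤ Sp + Sm + 2 * (n * (wBound * Q)) := by positivity
  have h3 : n * I ≤ 16 * B ^ 2 * (S + n * (wBound * Q)) + 8 * B ^ 2 * (Sp + Sm + 2 * (n * (wBound * Q))) := by
    have := mul_le_mul_of_nonneg_right hBB hT
    nlinarith
  have h4 : I ≤ (16 * B ^ 2 * (S + n * (wBound * Q)) + 8 * B ^ 2 * (Sp + Sm + 2 * (n * (wBound * Q)))) / n := by
    rw [le_div_iff₀ hn']; linarith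
  have h5 : (16 * B ^ 2 * (S + n * (wBound * Q)) + 8 * B ^ 2 * (Sp + Sm + 2 * (n * (wBound * Q)))) / n =
      16 * B ^ 2 * ((S + Sp + Sm) / n + 2 * wBound * Q) - 8 * B ^ 2 * ((Sp + Sm) / n) := by
    field_simp
    ring
  have h6 : 0 ≤ 8 * B ^ 2 * ((Sp + Sm) / n) := by positivity
  rw [h5] at h4
  linarith

/-! ### The risk bound -/

/-- An upper bound for the squared range of the estimator when the noise exceeds `t`. -/
noncomputable def tailEnvelope (t x : ℝ) : ℝ := 8 * Real.exp (-t ^ 2) * Real.exp ((1 + t) * |x|)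

theorem tailEnvelope_nonneg (t x : ℝ) : 0 ≤ tailEnvelope t x := by unfold tailEnvelope; positivity

/-- Chernoff device: `exp (t * (|x| - t)) ≥ 1` when `|x| ≥ t`, and `(2 + |x|)² ≤ 8 * exp |x|`. -/
theorem sq_le_tailEnvelope {t x : ℝ} (ht : 0 ≤ t) (h : t ≤ |x|) :
    (2 + |x|) ^ 2 ≤ tailEnvelope t x := by
  have h0 := abs_nonneg x
  have h1 := Real.quadratic_le_exp_of_nonneg h0
  have h2 : Real.exp |x| ≤ Real.exp (-t ^ 2) * Real.exp ((1 + t) * |x|) := by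
    rw [← Real.exp_add]
    refine Real.exp_le_exp.2 ?_
    nlinarith
  unfold tailEnvelope
  nlinarith

theorem integral_exp_mul_gaussian (t : ℝ) :
    ∫ x, Real.exp (t * x) ∂(gaussianReal 0 1) = Real.exp (t ^ 2 / 2) := by
  have := mgf_gaussianReal (p := gaussianReal 0 1) (X := id) (μ := 0) (v := 1) Measure.map_id t
  simpa [mgf] using this

theorem integrable_tailEnvelope (t : ℝ) : Integrable (tailEnvelope t) (gaussianReal 0 1) :=
  (integrable_exp_mul_abs (1 + t)).const_mul _

theorem integral_tailEnvelope_le (t : ℝ) :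
    ∫ x, tailEnvelope t x ∂(gaussianReal 0 1) ≤ 16 * Real.exp (1 / 2 + t - t ^ 2 / 2) := by
  unfold tailEnvelope
  rw [integral_const_mul]
  have h : ∫ x, Real.exp ((1 + t) * |x|) ∂(gaussianReal 0 1) ≤ 2 * Real.exp ((1 + t) ^ 2 / 2) := by
    have i1 := integrable_exp_mul_gaussianReal (μ := 0) (v := 1) (1 + t)
    have i2 := integrable_exp_mul_gaussianReal (μ := 0) (v := 1) (-(1 + t))
    refine (integral_mono (integrable_exp_mul_abs (1 + t)) (i1.add i2)
      fun x => exp_mul_abs_le (1 + t) x).trans ?_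
    simp only [Pi.add_apply]
    rw [integral_add i1 i2, integral_exp_mul_gaussian, integral_exp_mul_gaussian, neg_sq, two_mul]
  calc _ ≤ 8 * Real.exp (-t ^ 2) * (2 * Real.exp ((1 + t) ^ 2 / 2)) := by gcongr
    _ = 16 * (Real.exp (-t ^ 2) * Real.exp ((1 + t) ^ 2 / 2)) := by ring
    _ = _ := by rw [← Real.exp_add]; ring_nf

theorem logE_ge_one (x : ℝ) : 1 ≤ logE x := by
  unfold logE
  rw [Real.le_log_iff_exp_le (lt_of_lt_of_le (Real.exp_pos 1) (le_max_left _ _))]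
  exact le_max_left _ _

theorem le_exp_logE (x : ℝ) : x ≤ Real.exp (logE x) := by
  unfold logE
  rw [Real.exp_log (lt_of_lt_of_le (Real.exp_pos 1) (le_max_left _ _))]
  exact le_max_right _ _

/-- With `s = √(logE n) ≥ 1`, the exponent `1/2 + 4s - 8s²` is at most `-2s²`, so each of the `n`
terms is at most `16 / n²`. -/
theorem card_mul_integral_tailEnvelope_le {n : ℕ} (hn : 0 < n) :
    n * ∫ x, tailEnvelope (4 * √(logE n)) x ∂(gaussianReal 0 1) ≤ 16 / n := by
  have hn' : (0 : ℝ) < n := by exact_mod_cast hn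
  have hl := logE_ge_one n
  have hs1 : 1 ≤ √(logE n) := Real.one_le_sqrt.2 hl
  have hs2 : √(logE n) ^ 2 = logE n := Real.sq_sqrt (by linarith)
  have h1 := integral_tailEnvelope_le (4 * √(logE n))
  have h2 : Real.exp (1 / 2 + 4 * √(logE n) - (4 * √(logE n)) ^ 2 / 2) ≤ Real.exp (-(2 * logE n)) := by
    refine Real.exp_le_exp.2 ?_
    nlinarith
  have h3 : (n : ℝ) * n * Real.exp (-(2 * logE n)) ≤ 1 := by
    have h4 := le_exp_logE n
    calc _ ≤ Real.exp (logE n) * Real.exp (logE n) * Real.exp (-(2 * logE n)) := by gcongr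
      _ = 1 := by rw [← Real.exp_add, ← Real.exp_add]; ring_nf; simp
  rw [le_div_iff₀ hn']
  calc _ ≤ n * (16 * Real.exp (-(2 * logE n))) * n := by gcongr; exact h1.trans (by gcongr)
    _ = 16 * ((n : ℝ) * n * Real.exp (-(2 * logE n))) := by ring
    _ ≤ 16 := by linarith

theorem sqL2Dist_le_of_abs_sub_le {d : ℕ} {f g : Cube d → ℝ} {B : ℝ} (h : ∀ x, |f x - g x| ≤ B) :
    sqL2Dist f g ≤ ENNReal.ofReal (B ^ 2) := by
  calc sqL2Dist f g ≤ ∫⁻ _ : Cube d, ENNReal.ofReal (B ^ 2) :=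
        lintegral_mono fun x => ENNReal.ofReal_le_ofReal (sq_le_sq' (neg_le_of_abs_le (h x)) (le_of_abs_le (h x)))
    _ = _ := by simp

/-- For `e = 0` all `K + 1` terms equal 1 and `K` is logarithmic in `n`; for `e ≥ 1` the sum is
dominated by a geometric one of ratio at most `3/4`. -/
theorem chainSum_le_gammaIso {e K n : ℕ} (hK : 2 ^ K ≤ n) :
    chainSum e K ≤ 4 * logE n ^ (gammaIso (e + 2) - 1) := by
  have hr := chainRatio_pos
  have hr2 := chainRatio_sq
  have hr1 := chainRatio_le_one
  rcases Nat.eq_zero_or_pos e with rfl | he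
  · have hl := logE_ge_one n
    have hK' : (K : ℝ) * Real.log 2 ≤ logE n := by
      have h1 : (2 : ℝ) ^ K ≤ Real.exp (logE n) := (by exact_mod_cast hK : (2 : ℝ) ^ K ≤ n).trans (le_exp_logE n)
      have h2 := Real.log_le_log (by positivity) h1
      rwa [Real.log_exp, Real.log_pow] at h2
    have hlog : (1 : ℝ) / 2 ≤ Real.log 2 := by linarith [Real.log_two_gt_d9]
    have hK0 : (0 : ℝ) ≤ K := Nat.cast_nonneg K
    have h3 := mul_le_mul_of_nonneg_left hlog hK0
    simp [chainSum, gammaIso]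
    linarith
  · have hg : gammaIso (e + 2) - 1 = 0 := by simp [gammaIso, he.ne']
    rw [hg, pow_zero, mul_one]
    have hr3 : chainRatio ≤ 3 / 4 := by nlinarith
    have h1 : chainSum e K ≤ ∑ j ∈ Finset.range (K + 1), chainRatio ^ j :=
      Finset.sum_le_sum fun j _ => pow_le_pow_of_le_one hr.le hr1 (Nat.le_mul_of_pos_right j he)
    have h2 := geom_sum_mul_neg chainRatio (K + 1)
    have h3 : 0 < chainRatio ^ (K + 1) := by positivity
    have h4 : 0 ≤ ∑ j ∈ Finset.range (K + 1), chainRatio ^ j := Finset.sum_nonneg fun j _ => by positivity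
    nlinarith

/-- The constant of the risk bound in dimension `e + 2`. -/
noncomputable def riskConst (e : ℕ) : ℝ :=
  800 * (24 * chainConst e + (2 * wBound + 1) * ((e + 2 : ℕ) * 2 ^ (e + 2))) + 16

theorem riskConst_pos (e : ℕ) : 0 < riskConst e := by
  have := chainConst_pos e
  have := wBound_nonneg
  unfold riskConst
  positivity

/-- In `riskConst`, `800 = 16 * 25 * 2`: 25 from `(1 + 4√ℓ)² ≤ 25ℓ` and 2 from `2^(-K) ≤ 2
n^(-1/d)`. The factor `24 = 3 * 2 * 4` comes from three weights, the chaining bound and the bound on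
`chainSum`. -/
theorem risk_arith {e n K : ℕ} (hn : 0 < n) (hK1 : (2 ^ (e + 2)) ^ K ≤ n)
    (hK2 : n ≤ (2 * 2 ^ K) ^ (e + 2)) {T : ℝ}
    (hT : T ≤ 3 * (2 * chainConst e * 2 ^ (K * (e + 1)) * chainSum e K)) :
    16 * (1 + 4 * √(logE n)) ^ 2 * (T / n + (2 * wBound + 1) * ((e + 2 : ℕ) * 2 ^ (e + 2) / 2 ^ K)) +
      16 / n ≤
    riskConst e * (n : ℝ) ^ (-(1 / ((e + 2 : ℕ) : ℝ))) * logE n ^ gammaIso (e + 2) := by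
  have hn' : (0 : ℝ) < n := by exact_mod_cast hn
  have hn1 : (1 : ℝ) ≤ n := by exact_mod_cast hn
  have hl := logE_ge_one n
  have hs1 : 1 ≤ √(logE n) := Real.one_le_sqrt.2 hl
  have hs2 : √(logE n) ^ 2 = logE n := Real.sq_sqrt (by linarith)
  have hc := chainConst_pos e
  have hM := wBound_nonneg
  set r := (n : ℝ) ^ (-(1 / ((e + 2 : ℕ) : ℝ))) with hr
  have hr0 : 0 < r := Real.rpow_pos_of_pos hn' _
  have hd1 : (1 : ℝ) ≤ ((e + 2 : ℕ) : ℝ) := by exact_mod_cast (by omega : 1 ≤ e + 2)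
  have hinv : 1 / (n : ℝ) ≤ r := by
    rw [one_div, ← Real.rpow_neg_one, hr]
    refine Real.rpow_le_rpow_of_exponent_le hn1 (neg_le_neg ?_)
    rw [div_le_one (by linarith)]
    exact hd1
  have hmesh : 1 / (2 : ℝ) ^ K ≤ 2 * r := by
    have h1 : (n : ℝ) ^ (1 / ((e + 2 : ℕ) : ℝ)) ≤ 2 * 2 ^ K := by
      have h2 : (n : ℝ) ≤ (2 * 2 ^ K) ^ (e + 2) := by exact_mod_cast hK2
      have h3 := Real.rpow_le_rpow hn'.le h2 (by positivity : 0 ≤ 1 / ((e + 2 : ℕ) : ℝ))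
      rwa [one_div, Real.pow_rpow_inv_natCast (by positivity) (by omega), ← one_div] at h3
    rw [hr, Real.rpow_neg hn'.le, div_le_iff₀ (by positivity)]
    have h4 : 0 < (n : ℝ) ^ (1 / ((e + 2 : ℕ) : ℝ)) := Real.rpow_pos_of_pos hn' _
    calc (1 : ℝ) = ((n : ℝ) ^ (1 / ((e + 2 : ℕ) : ℝ)))⁻¹ * (n : ℝ) ^ (1 / ((e + 2 : ℕ) : ℝ)) := by
          field_simp
      _ ≤ ((n : ℝ) ^ (1 / ((e + 2 : ℕ) : ℝ)))⁻¹ * (2 * 2 ^ K) := by gcongr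
      _ = _ := by ring
  have hKn : 2 ^ K ≤ n := by
    refine le_trans ?_ hK1
    exact Nat.pow_le_pow_left (Nat.le_self_pow (by omega) 2) K
  have hS := chainSum_le_gammaIso (e := e) hKn
  set ℓ := logE n
  have hγ : ℓ ^ gammaIso (e + 2) = ℓ * ℓ ^ (gammaIso (e + 2) - 1) := by
    rw [← pow_succ']
    congr 1
    unfold gammaIso
    split_ifs <;> rfl
  set P := ℓ ^ (gammaIso (e + 2) - 1)
  have hP : 1 ≤ P := one_le_pow₀ hl
  have hvol : (2 : ℝ) ^ (K * (e + 1)) / n ≤ 1 / 2 ^ K := by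
    rw [div_le_div_iff₀ hn' (by positivity), one_mul, ← pow_add]
    have : ((2 : ℝ) ^ (e + 2)) ^ K ≤ n := by exact_mod_cast hK1
    rwa [← pow_mul, show (e + 2) * K = K * (e + 1) + K by ring] at this
  have hTn : T / n ≤ 24 * chainConst e * P * (2 * r) := by
    calc T / n ≤ 3 * (2 * chainConst e * 2 ^ (K * (e + 1)) * chainSum e K) / n := by gcongr
      _ ≤ 3 * (2 * chainConst e * 2 ^ (K * (e + 1)) * (4 * P)) / n := by gcongr
      _ = 24 * chainConst e * P * (2 ^ (K * (e + 1)) / n) := by ring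
      _ ≤ _ := by gcongr; exact hvol.trans hmesh
  have hQ : (2 * wBound + 1) * ((e + 2 : ℕ) * 2 ^ (e + 2) / 2 ^ K) ≤
      (2 * wBound + 1) * ((e + 2 : ℕ) * 2 ^ (e + 2)) * P * (2 * r) := by
    calc _ = (2 * wBound + 1) * ((e + 2 : ℕ) * 2 ^ (e + 2)) * 1 * (1 / 2 ^ K) := by ring
      _ ≤ _ := by gcongr
  have hB : (1 + 4 * √ℓ) ^ 2 ≤ 25 * ℓ := by nlinarith
  have hsum := add_le_add hTn hQ
  have h16 : 16 / (n : ℝ) ≤ 16 * r * (ℓ * P) := by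
    have : 1 ≤ ℓ * P := one_le_mul_of_one_le_of_one_le hl hP
    calc 16 / (n : ℝ) = 16 * (1 / n) * 1 := by ring
      _ ≤ _ := by gcongr
  have hrhs0 : 0 ≤ 24 * chainConst e * P * (2 * r) +
      (2 * wBound + 1) * ((e + 2 : ℕ) * 2 ^ (e + 2)) * P * (2 * r) := by positivity
  calc _ ≤ 16 * (25 * ℓ) * (24 * chainConst e * P * (2 * r) +
      (2 * wBound + 1) * ((e + 2 : ℕ) * 2 ^ (e + 2)) * P * (2 * r)) + 16 * r * (ℓ * P) := by
        refine add_le_add ?_ h16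
        exact (mul_le_mul_of_nonneg_left hsum (by positivity)).trans
          (mul_le_mul_of_nonneg_right (by linarith) hrhs0)
    _ = _ := by rw [hγ, riskConst]; ring

/-- A single integrable function of the sample dominates the loss of all least squares
estimators. -/
theorem exists_loss_envelope {e n : ℕ} (hn : 0 < n) :
    ∃ G : (Fin n → Cube (e + 2) × ℝ) → ℝ, Integrable G (sampleLaw (e + 2) n) ∧ (∀ z, 0 ≤ G z) ∧
      (∫ z, G z ∂(sampleLaw (e + 2) n)) ≤
        riskConst e * (n : ℝ) ^ (-(1 / ((e + 2 : ℕ) : ℝ))) * logE n ^ gammaIso (e + 2) ∧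
      ∀ z, ∀ f₀ ∈ isotonicClass (e + 2) ∩ supBall (e + 2) 1, ∀ f,
        IsIsotonicLSE (fun i => (z i).1) (fun i => f₀ (z i).1 + (z i).2) f →
        sqL2Dist f f₀ ≤ ENNReal.ofReal (G z) := by
  -- The finest dyadic grid with `2^(Kd) ≤ n`, that is, with at least about one observation per
  -- cell.
  set K := Nat.log (2 ^ (e + 2)) n with hKdef
  have hK1 : (2 ^ (e + 2)) ^ K ≤ n := Nat.pow_log_le_self _ hn.ne'
  have hK2 : n ≤ (2 * 2 ^ K) ^ (e + 2) := by
    have := (Nat.lt_pow_succ_log_self (b := 2 ^ (e + 2)) (Nat.one_lt_two_pow (by omega)) n).le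
    rwa [← hKdef, ← pow_mul, mul_comm, pow_mul, Nat.succ_eq_add_one, pow_succ' 2 K] at this
  have hK2' : (n : ℝ) ≤ (2 * 2 ^ K) ^ (e + 2) := by exact_mod_cast hK2
  obtain ⟨G₁, hi1, hI1, hb1⟩ := isWeight_one.exists_upperSet_envelope hK2'
  obtain ⟨G₂, hi2, hI2, hb2⟩ := isWeight_posPart.exists_upperSet_envelope hK2'
  obtain ⟨G₃, hi3, hI3, hb3⟩ := isWeight_negPart.exists_upperSet_envelope hK2'
  have nn1 : ∀ z, 0 ≤ G₁ z := fun z => (abs_nonneg _).trans (hb1 z ∅ isUpperSet_empty)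
  have nn2 : ∀ z, 0 ≤ G₂ z := fun z => (abs_nonneg _).trans (hb2 z ∅ isUpperSet_empty)
  have nn3 : ∀ z, 0 ≤ G₃ z := fun z => (abs_nonneg _).trans (hb3 z ∅ isUpperSet_empty)
  have hM := wBound_nonneg
  set t := 4 * √(logE n) with ht
  have ht0 : 0 ≤ t := by positivity
  set Q : ℝ := (2 * wBound + 1) * ((e + 2 : ℕ) * 2 ^ (e + 2) / 2 ^ K) with hQ
  have hQ0 : 0 ≤ Q := by positivity
  have htail : ∀ i : Fin n, Integrable (fun z : Fin n → Cube (e + 2) × ℝ => tailEnvelope t (z i).2)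
      (sampleLaw (e + 2) n) ∧ ∫ z, tailEnvelope t (z i).2 ∂(sampleLaw (e + 2) n) =
        ∫ x, tailEnvelope t x ∂(gaussianReal 0 1) := by
    intro i
    have hmp : MeasurePreserving (fun z : Fin n → Cube (e + 2) × ℝ => (z i).2) (sampleLaw (e + 2) n)
        (gaussianReal 0 1) :=
      measurePreserving_snd.comp (measurePreserving_eval (fun _ : Fin n => obsLaw (e + 2)) i)
    refine ⟨hmp.integrable_comp_of_integrable (integrable_tailEnvelope t), ?_⟩
    rw [← hmp.map_eq, integral_map hmp.measurable.aemeasurable]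
    rw [hmp.map_eq]
    exact (integrable_tailEnvelope t).aestronglyMeasurable
  have htS : Integrable (fun z : Fin n → Cube (e + 2) × ℝ => ∑ i, tailEnvelope t (z i).2)
      (sampleLaw (e + 2) n) := integrable_finsetSum _ fun i _ => (htail i).1
  have hi12 : Integrable (fun z => G₁ z + G₂ z + G₃ z) (sampleLaw (e + 2) n) := (hi1.add hi2).add hi3
  have hi12' : Integrable (fun z => G₁ z + G₂ z) (sampleLaw (e + 2) n) := hi1.add hi2
  have hmain : Integrable (fun z => 16 * (1 + t) ^ 2 * ((G₁ z + G₂ z + G₃ z) / n + Q))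
      (sampleLaw (e + 2) n) := ((hi12.div_const _).add (integrable_const _)).const_mul _
  refine ⟨fun z => 16 * (1 + t) ^ 2 * ((G₁ z + G₂ z + G₃ z) / n + Q) +
    ∑ i, tailEnvelope t (z i).2, hmain.add htS, ?_, ?_, ?_⟩
  · intro z
    have := nn1 z
    have := nn2 z
    have := nn3 z
    have := Finset.sum_nonneg fun i (_ : i ∈ Finset.univ) => tailEnvelope_nonneg t (z i).2
    positivity
  · rw [integral_add hmain htS, integral_const_mul, integral_add (hi12.div_const _) (integrable_const _),
      integral_div, integral_add hi12' hi3, integral_add hi1 hi2, integral_finsetSum _ fun i _ => (htail i).1]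
    simp_rw [fun i => (htail i).2]
    have h1 := card_mul_integral_tailEnvelope_le hn
    rw [← ht] at h1
    simp only [integral_const, probReal_univ, smul_eq_mul, one_mul, Finset.sum_const, Finset.card_univ,
      Fintype.card_fin, nsmul_eq_mul]
    refine le_trans (add_le_add le_rfl h1) (risk_arith hn hK1 hK2 ?_)
    linarith
  · rintro z f₀ ⟨hf₀, hf₀B⟩ f hf
    have hm : 0 < 2 ^ K := by positivity
    by_cases hgood : ∀ i, |(z i).2| ≤ t
    · refine (hf.sqL2Dist_le (m := 2 ^ K) (by omega) hm hn (hb1 z) (hb2 z) (hb3 z) hf₀ (B := 1 + t) (by linarith)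
        (fun x => (hf₀B x).trans (by linarith))
        (fun i => (abs_add_le _ _).trans (add_le_add (hf₀B _) (hgood i)))).trans ?_
      refine ENNReal.ofReal_le_ofReal ?_
      have := Finset.sum_nonneg fun i (_ : i ∈ Finset.univ) => tailEnvelope_nonneg t (z i).2
      simp only [hQ]
      push_cast at *
      linarith
    · push Not at hgood
      obtain ⟨j, hj⟩ := hgood
      -- The largest noise variable bounds the estimator, so its own tail term alone dominates the
      -- loss.
      obtain ⟨i, -, hi⟩ := Finset.exists_max_image Finset.univ (fun i => |(z i).2|) ⟨j, Finset.mem_univ j⟩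
      have hti : t ≤ |(z i).2| := hj.le.trans (hi j (Finset.mem_univ j))
      have hfB : ∀ x, |f x| ≤ 1 + |(z i).2| := hf.abs_le fun k =>
        (abs_add_le _ _).trans (add_le_add (hf₀B _) (hi k (Finset.mem_univ k)))
      refine (sqL2Dist_le_of_abs_sub_le (B := 2 + |(z i).2|) fun x => ?_).trans
        (ENNReal.ofReal_le_ofReal ?_)
      · have h1 := hfB x
        have h2 : |f₀ x| ≤ 1 := hf₀B x
        have h3 := abs_sub (f x) (f₀ x)
        linarith
      · have h1 := sq_le_tailEnvelope ht0 hti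
        have h2 := Finset.single_le_sum (f := fun i => tailEnvelope t (z i).2)
          (fun i _ => tailEnvelope_nonneg t _) (Finset.mem_univ i)
        have := nn1 z
        have := nn2 z
        have := nn3 z
        have h3 : 0 ≤ 16 * (1 + t) ^ 2 * ((G₁ z + G₂ z + G₃ z) / n + Q) := by positivity
        linarith

/-! ### Transfer to an arbitrary probability space and to outer expectations. -/

theorem IsDesignNoise.aemeasurable_sample {d n : ℕ} {Ω : Type*} [MeasurableSpace Ω] {μ : Measure Ω}
    {X : Fin n → Ω → Cube d} {ξ : Fin n → Ω → ℝ} (h : IsDesignNoise μ X ξ) :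
    AEMeasurable (fun ω i => (X i ω, ξ i ω)) μ :=
  aemeasurable_pi_lambda _ fun i => (h.law_X i).aemeasurable.prodMk (h.law_noise i).aemeasurable

/-- The three independence assumptions give a product of two product measures; exchanging pairs of
families with families of pairs turns it into `sampleLaw`. -/
theorem IsDesignNoise.map_sample {d n : ℕ} {Ω : Type*} [MeasurableSpace Ω] {μ : Measure Ω}
    [IsProbabilityMeasure μ] {X : Fin n → Ω → Cube d} {ξ : Fin n → Ω → ℝ}
    (h : IsDesignNoise μ X ξ) : μ.map (fun ω i => (X i ω, ξ i ω)) = sampleLaw d n := by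
  have hX : AEMeasurable (fun ω i => X i ω) μ := aemeasurable_pi_lambda _ fun i => (h.law_X i).aemeasurable
  have hξ : AEMeasurable (fun ω i => ξ i ω) μ :=
    aemeasurable_pi_lambda _ fun i => (h.law_noise i).aemeasurable
  have e1 := (iIndepFun_iff_map_fun_eq_pi_map fun i => (h.law_X i).aemeasurable).1 h.indep_X
  have e2 := (iIndepFun_iff_map_fun_eq_pi_map fun i => (h.law_noise i).aemeasurable).1 h.indep_noise
  have e3 := (indepFun_iff_map_prod_eq_prod_map_map hX hξ).1 h.indep_X_noise
  simp_rw [fun i => (h.law_X i).map_eq] at e1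
  simp_rw [fun i => (h.law_noise i).map_eq] at e2
  rw [e1, e2] at e3
  have hmp := (measurePreserving_arrowProdEquivProdArrow (Cube d) ℝ (Fin n)
    (fun _ => volume) (fun _ => gaussianReal 0 1)).symm
  unfold sampleLaw obsLaw
  rw [← hmp.map_eq, ← e3, AEMeasurable.map_map_of_aemeasurable hmp.measurable.aemeasurable (hX.prodMk hξ)]
  rfl

/-- A measurable majorant valid everywhere is obtained by setting a measurable version of `G` to `⊤`
on a measurable null set covering the exceptional points. -/
theorem outerExpectation_le_of_ae_le {Ω : Type*} [MeasurableSpace Ω] {μ : Measure Ω}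
    {F G : Ω → ℝ≥0∞} (hG : AEMeasurable G μ) (h : ∀ᵐ ω ∂μ, F ω ≤ G ω) :
    outerExpectation μ F ≤ ∫⁻ ω, G ω ∂μ := by
  classical
  have hae : ∀ᵐ ω ∂μ, F ω ≤ hG.mk G ω := by
    filter_upwards [h, hG.ae_eq_mk] with ω h1 h2
    rwa [← h2]
  set N := toMeasurable μ {ω | ¬ F ω ≤ hG.mk G ω} with hN
  have hNm : MeasurableSet N := measurableSet_toMeasurable _ _
  have hN0 : μ N = 0 := by rw [hN, measure_toMeasurable]; exact hae
  have hmeas : Measurable fun ω => if ω ∈ N then (⊤ : ℝ≥0∞) else hG.mk G ω :=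
    Measurable.ite hNm measurable_const hG.measurable_mk
  have hle : ∀ ω, F ω ≤ if ω ∈ N then (⊤ : ℝ≥0∞) else hG.mk G ω := by
    intro ω
    by_cases hω : ω ∈ N
    · simp [hω]
    · rw [if_neg hω]
      by_contra hcon
      exact hω (subset_toMeasurable μ _ hcon)
  calc outerExpectation μ F ≤ ∫⁻ ω, (if ω ∈ N then (⊤ : ℝ≥0∞) else hG.mk G ω) ∂μ :=
        iInf_le_of_le _ (iInf_le_of_le hmeas (iInf_le_of_le hle le_rfl))
    _ = ∫⁻ ω, G ω ∂μ := by
        refine lintegral_congr_ae ?_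
        have hNae : ∀ᵐ ω ∂μ, ω ∉ N := measure_eq_zero_iff_ae_notMem.1 hN0
        filter_upwards [hNae, hG.ae_eq_mk] with ω h1 h2
        rw [if_neg h1, h2]

end IsotonicRegression

theorem theorem7 (d : ℕ) (hd : 2 ≤ d) :
    ∃ C : ℝ, 0 < C ∧ ∀ n : ℕ, 1 ≤ n →
      ∀ f₀ ∈ IsotonicRegression.isotonicClass d ∩ IsotonicRegression.supBall d 1,
      ∀ (Ω : Type*) [MeasurableSpace Ω] (μ : Measure Ω) [IsProbabilityMeasure μ]
        (X : Fin n → Ω → IsotonicRegression.Cube d) (ξ : Fin n → Ω → ℝ),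
        IsotonicRegression.IsDesignNoise μ X ξ →
      ∀ fhat : Ω → IsotonicRegression.Cube d → ℝ,
        (∀ᵐ ω ∂μ, IsotonicRegression.IsIsotonicLSE (fun i => X i ω)
          (fun i => f₀ (X i ω) + ξ i ω) (fhat ω)) →
        IsotonicRegression.outerExpectation μ
            (fun ω => IsotonicRegression.sqL2Dist (fhat ω) f₀) ≤
          ENNReal.ofReal (C * (n : ℝ) ^ (-(1 / (d : ℝ))) *
            IsotonicRegression.logE n ^ IsotonicRegression.gammaIso d) := by
  obtain ⟨e, rfl⟩ : ∃ e, d = e + 2 := ⟨d - 2, by omega⟩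
  refine ⟨IsotonicRegression.riskConst e, IsotonicRegression.riskConst_pos e, ?_⟩
  intro n hn f₀ hf₀ Ω _ μ _ X ξ hXξ fhat hfhat
  obtain ⟨G, hGi, hG0, hGI, hGb⟩ := IsotonicRegression.exists_loss_envelope (e := e) (n := n) hn
  have hZ := hXξ.aemeasurable_sample
  have hmap := hXξ.map_sample
  have hGm : AEMeasurable (fun z => ENNReal.ofReal (G z))
      (μ.map fun ω i => (X i ω, ξ i ω)) := by
    rw [hmap]
    exact hGi.aemeasurable.ennreal_ofReal
  refine (IsotonicRegression.outerExpectation_le_of_ae_le (hGm.comp_aemeasurable hZ) ?_).trans ?_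
  · filter_upwards [hfhat] with ω hω
    exact hGb (fun i => (X i ω, ξ i ω)) f₀ hf₀ (fhat ω) hω
  · calc _ = ∫⁻ z, ENNReal.ofReal (G z) ∂(μ.map fun ω i => (X i ω, ξ i ω)) :=
          (lintegral_map' hGm hZ).symm
      _ = ENNReal.ofReal (∫ z, G z ∂(IsotonicRegression.sampleLaw (e + 2) n)) := by
          rw [hmap, ofReal_integral_eq_lintegral_ofReal hGi (Filter.Eventually.of_forall hG0)]
      _ ≤ _ := ENNReal.ofReal_le_ofReal hGI
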